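/- Let $M$ be a $d$-dimensional ($d\ge 1$) closed, connected, locally Euclidean (i.e. flat Riemannian) manifold, and let $\|x-y\|_2$ denote its (geodesic, locally Euclidean) distance. Let $X_{\mathrm p}=(x_{\mathrm p 1},\dots,x_{\mathrm p n})$ and $X_{\mathrm q}=(x_{\mathrm q 1},\dots,x_{\mathrm q n})$ be independent samples that are uniformly distributed on $M$, let $\lambda>0$, and let $K_{ij}=e^{-\|x_{\mathrm p i}-x_{\mathrm q j}\|_2/\lambda}$. Let $x_{\mathrm l 1},\dots,x_{\mathrm l l}\in M$ be landmarks fixed a priori, with pairwise distances at least $2R>0$, and let $K_{\mathrm{Nys}}=UA^{-1}V$ be the Nyström approximation, where $U_{ia}=e^{-\|x_{\mathrm p i}-x_{\mathrm l a}\|_2/\lambda}$, $A_{ab}=e^{-\|x_{\mathrm l a}-x_{\mathrm l b}\|_2/\lambda}$ and $V_{bj}=e^{-\|x_{\mathrm l b}-x_{\mathrm q j}\|_2/\lambda}$. For $1\le k\le n$ let $x_{\mathrm q i_k}$ be the $k$-th nearest neighbor of $x_{\mathrm p i}$ in $X_{\mathrm q}$ and $\delta_k$ the $k$-th nearest neighbor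 distance. Then $$\mathbb{E}[K_{i,i_k}-K_{\mathrm{Nys},i,i_k}]=\mathbb{E}[e^{-\delta_k/\lambda}]-\mathbb{E}[K_{\mathrm{Nys},i,i_k}].$$ If moreover $M$ is Euclidean at the scale $R$, i.e. every ball of radius $R$ in $M$ is a Euclidean ball (the injectivity radius of $M$ is at least $R$), then $$\mathbb{E}[K_{\mathrm{Nys},i,i_k}]\le\frac{d\,(\Gamma(d)-\Gamma(d,2R/\lambda))}{(2R/\lambda)^d}+\mathcal{O}(e^{-2R/\lambda})\qquad (R/\lambda\to\infty),$$ where $\Gamma(\cdot,\cdot)$ is the upper incomplete Gamma function. That is, there are constants $C$ and $c$ that depend only on $d$ such that, whenever $R/\lambda\ge c$, the matrix $A$ is invertible and the bound holds with error term $C e^{-2R/\lambda}$. -/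

import Mathlib

open MeasureTheory ProbabilityTheory

namespace NystromError

/-- The open ball of radius `r` around `x` is Euclidean: normal coordinates `φ` map the Euclidean
ball of radius `r` bijectively and locally isometrically onto it, and radial distances are the
Euclidean ones. In a flat Riemannian manifold this says that the injectivity radius at `x` is at
least `r` (`φ` is the exponential map). -/
def IsEuclideanBall (d : ℕ) {M : Type*} [MetricSpace M] (x : M) (r : ℝ) : Prop :=
  ∃ φ : EuclideanSpace ℝ (Fin d) → M,
    Set.BijOn φ (Metric.ball 0 r) (Metric.ball x r) ∧
    (∀ v ∈ Metric.ball (0 : EuclideanSpace ℝ (Fin d)) r, dist x (φ v) = ‖v‖) ∧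
    (∀ v ∈ Metric.ball (0 : EuclideanSpace ℝ (Fin d)) r, ∃ ε > 0,
      ∀ u ∈ Metric.ball v ε ∩ Metric.ball 0 r, ∀ w ∈ Metric.ball v ε ∩ Metric.ball 0 r,
        dist (φ u) (φ w) = dist u w)

/-- A closed (compact, boundaryless, connected), locally Euclidean (flat) `d`-dimensional manifold
with its geodesic distance, described as a metric space: compact, nonempty, any two points are
joined by a shortest path whose length is their distance, and every point has a ball that is a
Euclidean ball of dimension `d`. -/
structure IsClosedLocallyEuclidean (d : ℕ) (M : Type*) [MetricSpace M] : Prop where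
  compact : CompactSpace M
  nonempty : Nonempty M
  geodesic : ∀ x y : M, ∃ γ : ℝ → M, γ 0 = x ∧ γ (dist x y) = y ∧
    ∀ s ∈ Set.Icc 0 (dist x y), ∀ t ∈ Set.Icc 0 (dist x y), dist (γ s) (γ t) = |s - t|
  locallyEuclidean : ∀ x : M, ∃ r > 0, IsEuclideanBall d x r

/-- The similarity matrix `exp (-‖x i - y j‖ / lam)` between two families of points. -/
noncomputable def kernelMatrix {M : Type*} [MetricSpace M] {ι κ : Type*} (lam : ℝ)
    (x : ι → M) (y : κ → M) : Matrix ι κ ℝ :=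
  Matrix.of fun i j => Real.exp (-dist (x i) (y j) / lam)

/-- The Nyström approximation `U A⁻¹ V` of `kernelMatrix lam x y` with landmarks `L`. -/
noncomputable def nystrom {M : Type*} [MetricSpace M] {ι κ : Type*} {l : ℕ} (lam : ℝ)
    (L : Fin l → M) (x : ι → M) (y : κ → M) : Matrix ι κ ℝ :=
  kernelMatrix lam x L * (kernelMatrix lam L L)⁻¹ * kernelMatrix lam L y

/-- The `k`-th nearest neighbor distance (`k = 1` is the nearest neighbor): the smallest radius
within which `x` has at least `k` of the points `y j`. -/
noncomputable def kthNearestDist {M : Type*} [MetricSpace M] {n : ℕ} (k : ℕ) (x : M)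
    (y : Fin n → M) : ℝ :=
  sInf {r : ℝ | k ≤ (Finset.univ.filter fun j => dist x (y j) ≤ r).card}

/-- `y j` is a `k`-th nearest neighbor of `x` among the points `y`: fewer than `k` points are
strictly closer and at least `k` points are at most as far. -/
def IsKthNearest {M : Type*} [MetricSpace M] {n : ℕ} (k : ℕ) (x : M) (y : Fin n → M)
    (j : Fin n) : Prop :=
  (Finset.univ.filter fun m => dist x (y m) < dist x (y j)).card < k ∧
    k ≤ (Finset.univ.filter fun m => dist x (y m) ≤ dist x (y j)).card

/-- The upper incomplete Gamma function `Γ(s, x)`. -/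
noncomputable def upperGamma (s x : ℝ) : ℝ :=
  ∫ t in Set.Ioi x, t ^ (s - 1) * Real.exp (-t)

end NystromError

/-!
The Nyström kernel is `u ⬝ᵥ A⁻¹ v`, where `u` and `v` are the similarities of the two points `x`,
`y` to the landmarks. The similarity of a point to its `k`-th nearest neighbor is a function of
the `k`-th nearest neighbor distance, which gives the formula for the expected error.

For the bound, put `ρ = 2 R / lam`. On a geodesic space whose balls of radius `R` are Euclidean,
balls grow at most geometrically in steps of `R / 2` (`exists_cover_ball`), hence a sum of `exp
(-dist / lam)` over landmarks at a distance of at least `s` is `O(exp (-s / lam))` (`sum_exp_le`).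
So `A` is the identity up to `O(exp (-ρ))`, and the Nyström kernel is at most the product kernel
`u ⬝ᵥ v` up to this error (`nystrom_le`). Let `h x = ∑ a, exp (-2 dist x (L a) / lam)`, and let
`G` be the leading term. The balls of radius `R` around the landmarks are disjoint, and `G` is the
mean of `exp (-2 ‖v‖ / lam)` over such a ball, so that the mean of `h` over `M` is at most `G +
O(exp (-ρ))` (`integral_sum_exp_le`).

It remains to compare the expectation of `u ⬝ᵥ v` with the mean of `h`. While `u ⬝ᵥ v` is at most
`(h x + h y) / 2`, the neighbor `y` need not be uniform, because a flat manifold need not be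
homogeneous. However, the distances to `x`, truncated at `R`, have the same law for every `x`.
Therefore an event described by truncated distances is independent of `x`, and, by Fubini and the
symmetry of the distance, also of each sample point (`prod_pi_fst_mem`, `prod_pi_apply_mem`):
given that `x` and `y` are closer than `R`, each of them is uniform. If they are not, then `u ⬝ᵥ v
= O(exp (-ρ / 4))`, which is less than `G`, since `G` decays only like `ρ ^ (-d)`. Both cases
together give `G + O(exp (-ρ))` (`integral_le_of_kthNearest`).
-/

namespace NystromError

/-! ### Locally isometric maps -/

/-- A map that preserves distances locally on a set. -/
def LocallyIsometricOn {X Y : Type*} [MetricSpace X] [MetricSpace Y] (φ : X → Y) (s : Set X) :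
    Prop :=
  ∀ v ∈ s, ∃ ε > 0, ∀ u ∈ Metric.ball v ε ∩ s, ∀ w ∈ Metric.ball v ε ∩ s,
    dist (φ u) (φ w) = dist u w

theorem LocallyIsometricOn.continuousOn {X Y : Type*} [MetricSpace X] [MetricSpace Y] {φ : X → Y}
    {s : Set X} (h : LocallyIsometricOn φ s) : ContinuousOn φ s := by
  intro v hv
  obtain ⟨ε, hε, H⟩ := h v hv
  rw [Metric.continuousWithinAt_iff]
  intro δ hδ
  refine ⟨min ε δ, lt_min hε hδ, fun {u} hu hd => ?_⟩
  rw [H u ⟨lt_of_lt_of_le hd (min_le_left _ _), hu⟩ v ⟨Metric.mem_ball_self hε, hv⟩]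
  exact lt_of_lt_of_le hd (min_le_right _ _)

/-- A local isometry on a convex set does not increase distances: along a segment, the distance to
the image of the starting point grows with slope at most the speed of the segment. -/
theorem LocallyIsometricOn.dist_le {E M : Type*} [NormedAddCommGroup E] [NormedSpace ℝ E]
    [MetricSpace M] {φ : E → M} {s : Set E} (h : LocallyIsometricOn φ s) (hs : Convex ℝ s)
    {u w : E} (hu : u ∈ s) (hw : w ∈ s) : dist (φ u) (φ w) ≤ dist u w := by
  set p : ℝ → E := fun t => u + t • (w - u) with hp
  have hpc : Continuous p := by fun_prop
  have hps : ∀ t ∈ Set.Icc (0 : ℝ) 1, p t ∈ s := fun t ht =>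
    hs.add_smul_sub_mem hu hw ht
  have hpd : ∀ t t', dist (p t) (p t') = |t - t'| * dist u w := by
    intro t t'
    have : p t - p t' = (t - t') • (w - u) := by simp only [hp]; module
    rw [dist_eq_norm, this, norm_smul, Real.norm_eq_abs, dist_comm u w, dist_eq_norm w u]
  have hφc : ContinuousOn (fun t => φ (p t)) (Set.Icc 0 1) :=
    h.continuousOn.comp hpc.continuousOn hps
  have key := image_le_of_liminf_slope_right_le_deriv_boundary
    (f := fun t => dist (φ u) (φ (p t))) (a := 0) (b := 1)
    ((continuous_const.dist continuous_id).comp_continuousOn hφc)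
    (B := fun t => t * dist u w) (B' := fun _ => dist u w)
    (by simp [hp]) (by fun_prop)
    (fun x _ => by simpa using ((hasDerivAt_id x).mul_const (dist u w)).hasDerivWithinAt)
    (by
      intro x hx r hr
      obtain ⟨ε, hε, H⟩ := h (p x) (hps x ⟨hx.1, hx.2.le⟩)
      have h1 : ∀ᶠ z in nhdsWithin x (Set.Ioi x), p z ∈ Metric.ball (p x) ε :=
        (hpc.continuousAt.eventually (Metric.ball_mem_nhds _ hε)).filter_mono nhdsWithin_le_nhds
      have h2 : ∀ᶠ z in nhdsWithin x (Set.Ioi x), z ∈ Set.Ioo x 1 := Ioo_mem_nhdsGT hx.2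
      refine (h1.and h2).frequently.mono fun z ⟨hz1, hz2⟩ => ?_
      have hz : z ∈ Set.Icc (0 : ℝ) 1 := ⟨hx.1.trans hz2.1.le, hz2.2.le⟩
      have e := H (p x) ⟨Metric.mem_ball_self hε, hps x ⟨hx.1, hx.2.le⟩⟩ (p z) ⟨hz1, hps z hz⟩
      rw [hpd, abs_sub_comm, abs_of_pos (sub_pos.2 hz2.1)] at e
      have tri := dist_triangle (φ u) (φ (p x)) (φ (p z))
      refine lt_of_le_of_lt ?_ hr
      rw [slope_def_field, div_le_iff₀ (sub_pos.2 hz2.1)]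
      linarith)
  have := key (Set.right_mem_Icc.2 zero_le_one)
  simpa [hp] using this

/-- An injective local isometry preserves the Hausdorff measure. The set is cut into countably many
measurable pieces on which the map is an isometry; the images are measurable and disjoint. -/
theorem LocallyIsometricOn.hausdorffMeasure_image {X Y : Type*} [MetricSpace X] [MetricSpace Y]
    [PolishSpace X] [MeasurableSpace X] [BorelSpace X] [MeasurableSpace Y] [BorelSpace Y]
    {φ : X → Y} {s : Set X} (h : LocallyIsometricOn φ s) (hinj : Set.InjOn φ s) {t : Set X}
    (hts : t ⊆ s) (ht : MeasurableSet t) {d : ℝ} (hd : 0 ≤ d) :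
    Measure.hausdorffMeasure d (φ '' t) = Measure.hausdorffMeasure d t := by
  have local_eq : ∀ v ∈ s, ∃ ε > 0, ∀ a ⊆ Metric.ball v ε ∩ s,
      Measure.hausdorffMeasure d (φ '' a) = Measure.hausdorffMeasure d a := by
    intro v hv
    obtain ⟨ε, hε, H⟩ := h v hv
    refine ⟨ε, hε, fun a ha => ?_⟩
    have i1 : Isometry (fun x : a => φ x) :=
      Isometry.of_dist_eq fun x y => H x (ha x.2) y (ha y.2)
    have e1 := i1.hausdorffMeasure_image (Or.inl hd) (Set.univ)
    have e2 := (isometry_subtype_coe (s := a)).hausdorffMeasure_image (Or.inl hd) (Set.univ)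
    have r1 : (fun x : a => φ x) '' Set.univ = φ '' a := by
      ext y; simp
    have r2 : (fun x : a => (x : X)) '' Set.univ = a := by
      ext y; simp
    rw [r1] at e1
    rw [r2] at e2
    rw [e1, e2]
  choose! ε hε H using local_eq
  obtain ⟨c, hcs, hcc, hcov⟩ := TopologicalSpace.countable_cover_nhdsWithin
    (f := fun v => Metric.ball v (ε v)) (s := s)
    (fun v hv => mem_nhdsWithin_of_mem_nhds (Metric.ball_mem_nhds v (hε v hv)))
  rcases s.eq_empty_or_nonempty with rfl | hne
  · rw [Set.subset_empty_iff.1 hts]; simp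
  have hcne : c.Nonempty := by
    obtain ⟨v, hv⟩ := hne
    obtain ⟨w, hw, -⟩ := Set.mem_iUnion₂.1 (hcov hv)
    exact ⟨w, hw⟩
  obtain ⟨g, rfl⟩ := hcc.exists_eq_range hcne
  have hgs : ∀ n, g n ∈ s := fun n => hcs ⟨n, rfl⟩
  set A : ℕ → Set X := disjointed (fun n => Metric.ball (g n) (ε (g n))) with hA
  have hAm : ∀ n, MeasurableSet (A n) :=
    fun n => MeasurableSet.disjointed (fun n => measurableSet_ball) n
  have hAd : Pairwise (Function.onFun Disjoint A) := disjoint_disjointed _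
  have hAU : t ⊆ ⋃ n, A n := by
    rw [hA, iUnion_disjointed]
    intro v hv
    obtain ⟨w, ⟨n, rfl⟩, hn⟩ := Set.mem_iUnion₂.1 (hcov (hts hv))
    exact Set.mem_iUnion.2 ⟨n, hn⟩
  have ht_eq : t = ⋃ n, t ∩ A n := by
    rw [← Set.inter_iUnion, Set.inter_eq_left.2 hAU]
  have e1 : Measure.hausdorffMeasure d t = ∑' n, Measure.hausdorffMeasure d (t ∩ A n) := by
    conv_lhs => rw [ht_eq]
    exact measure_iUnion (fun i j hij => (hAd hij).mono Set.inter_subset_right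
      Set.inter_subset_right) fun n => ht.inter (hAm n)
  have e2 : Measure.hausdorffMeasure d (φ '' t) =
      ∑' n, Measure.hausdorffMeasure d (φ '' (t ∩ A n)) := by
    conv_lhs => rw [ht_eq, Set.image_iUnion]
    refine measure_iUnion (fun i j hij => ?_) fun n => ?_
    · rw [Function.onFun, Set.disjoint_iff_inter_eq_empty,
        ← hinj.image_inter (Set.inter_subset_left.trans hts) (Set.inter_subset_left.trans hts),
        ((hAd hij).mono Set.inter_subset_right Set.inter_subset_right).inter_eq, Set.image_empty]
    · exact (ht.inter (hAm n)).image_of_continuousOn_injOn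
        (h.continuousOn.mono (Set.inter_subset_left.trans hts))
        (hinj.mono (Set.inter_subset_left.trans hts))
  rw [e1, e2]
  refine tsum_congr fun n => H (g n) (hgs n) _ fun v hv => ⟨?_, hts hv.1⟩
  exact disjointed_subset _ n hv.2

/-! ### Euclidean balls -/

/-- In normal coordinates, the volume on a Euclidean ball is the Euclidean one: the distance to
the center has the same distribution as the norm on the ball of `EuclideanSpace`. -/
theorem IsEuclideanBall.map_dist {d : ℕ} {M : Type*} [MetricSpace M] [MeasurableSpace M]
    [BorelSpace M] {x : M} {r : ℝ} (h : IsEuclideanBall d x r) :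
    ((Measure.hausdorffMeasure (d : ℝ)).restrict (Metric.ball x r)).map (dist x) =
      ((Measure.hausdorffMeasure (d : ℝ)).restrict
        (Metric.ball (0 : EuclideanSpace ℝ (Fin d)) r)).map norm := by
  obtain ⟨φ, hbij, hdist, hloc⟩ := h
  have hloc : LocallyIsometricOn φ (Metric.ball 0 r) := hloc
  have hdm : Measurable (dist x) := (continuous_const.dist continuous_id).measurable
  ext T hT
  rw [Measure.map_apply hdm hT, Measure.map_apply measurable_norm hT,
    Measure.restrict_apply (hdm hT), Measure.restrict_apply (measurable_norm hT),
    ← hloc.hausdorffMeasure_image hbij.injOn Set.inter_subset_right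
      ((measurable_norm hT).inter measurableSet_ball) (Nat.cast_nonneg d)]
  congr 1
  ext y
  constructor
  · rintro ⟨hy, hyb⟩
    obtain ⟨v, hv, rfl⟩ := hbij.surjOn hyb
    refine ⟨v, ⟨?_, hv⟩, rfl⟩
    have hy : dist x (φ v) ∈ T := hy
    rwa [hdist v hv] at hy
  · rintro ⟨v, ⟨hv1, hv⟩, rfl⟩
    refine ⟨?_, hbij.mapsTo hv⟩
    show dist x (φ v) ∈ T
    rwa [hdist v hv]

/-- The number of balls of half the radius needed to cover a Euclidean ball is bounded in terms of
the dimension. -/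
theorem exists_cover_isEuclideanBall (d : ℕ) : ∃ N : ℕ, ∀ (M : Type*) [MetricSpace M] (x : M)
    (R : ℝ), 0 < R → IsEuclideanBall d x R →
      ∃ T : Finset M, T.card ≤ N ∧ Metric.ball x R ⊆ ⋃ y ∈ T, Metric.ball y (R / 2) := by
  classical
  have tb : TotallyBounded (Metric.ball (0 : EuclideanSpace ℝ (Fin d)) 1) :=
    (isCompact_closedBall (0 : EuclideanSpace ℝ (Fin d)) 1).totallyBounded.subset
      Metric.ball_subset_closedBall
  obtain ⟨t, hts, htf, hcov⟩ := Metric.finite_approx_of_totallyBounded tb (1 / 2) (by norm_num)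
  refine ⟨htf.toFinset.card, ?_⟩
  rintro M _ x R hR ⟨φ, hbij, -, hloc⟩
  have hloc : LocallyIsometricOn φ (Metric.ball 0 R) := hloc
  refine ⟨htf.toFinset.image fun c => φ (R • c), Finset.card_image_le, ?_⟩
  intro y hy
  obtain ⟨v, hv, rfl⟩ := hbij.surjOn hy
  have hv' : R⁻¹ • v ∈ Metric.ball (0 : EuclideanSpace ℝ (Fin d)) 1 := by
    rw [mem_ball_zero_iff] at hv ⊢
    rw [norm_smul, norm_inv, Real.norm_of_nonneg hR.le, inv_mul_lt_iff₀ hR]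
    simpa using hv
  obtain ⟨c, hc, hcd⟩ := Set.mem_iUnion₂.1 (hcov hv')
  refine Set.mem_iUnion₂.2 ⟨φ (R • c), Finset.mem_image.2 ⟨c, by simpa using hc, rfl⟩, ?_⟩
  have hcR : R • c ∈ Metric.ball (0 : EuclideanSpace ℝ (Fin d)) R := by
    have := hts hc
    rw [mem_ball_zero_iff] at this ⊢
    rw [norm_smul, Real.norm_of_nonneg hR.le]
    nlinarith
  refine lt_of_le_of_lt (hloc.dist_le (convex_ball _ _) hv hcR) ?_
  have e : v = R • (R⁻¹ • v) := (smul_inv_smul₀ hR.ne' v).symm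
  rw [e, dist_smul₀, Real.norm_of_nonneg hR.le]
  rw [Metric.mem_ball] at hcd
  nlinarith

/-- Doubling along geodesics: a ball of radius `(j + 1) R / 2` is covered by `N ^ j` balls of
radius `R / 2`, if every ball of radius `R` is covered by `N` of them. -/
theorem exists_cover_ball {M : Type*} [MetricSpace M] {R : ℝ} {N : ℕ}
    (hgeo : ∀ x y : M, ∃ γ : ℝ → M, γ 0 = x ∧ γ (dist x y) = y ∧
      ∀ s ∈ Set.Icc 0 (dist x y), ∀ t ∈ Set.Icc 0 (dist x y), dist (γ s) (γ t) = |s - t|)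
    (hN : ∀ x : M, ∃ T : Finset M, T.card ≤ N ∧ Metric.ball x R ⊆ ⋃ y ∈ T, Metric.ball y (R / 2))
    (x : M) (j : ℕ) :
    ∃ T : Finset M, T.card ≤ N ^ j ∧
      Metric.ball x ((j + 1) * (R / 2)) ⊆ ⋃ y ∈ T, Metric.ball y (R / 2) := by
  classical
  induction j with
  | zero => exact ⟨{x}, by simp, by simp⟩
  | succ j ih =>
    obtain ⟨T, hT, hcov⟩ := ih
    choose S hS hScov using hN
    refine ⟨T.biUnion S, ?_, fun z hz => ?_⟩
    · rw [pow_succ]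
      exact Finset.card_biUnion_le_card_mul _ _ _ (fun y _ => hS y) |>.trans
        (Nat.mul_le_mul_right _ hT)
    · obtain ⟨γ, h0, h1, hγ⟩ := hgeo x z
      set D := dist x z with hD
      have hD0 : 0 ≤ D := dist_nonneg
      have hDlt : D < (j + 2) * (R / 2) := by
        have := Metric.mem_ball'.1 hz
        push_cast at this
        linarith
      -- the point dividing the geodesic in the ratio `(j + 1) : 1`
      have hj : (0 : ℝ) < j + 2 := by positivity
      set s := D * (j + 1) / (j + 2) with hs
      have hs0 : 0 ≤ s := by positivity
      have hsD : D - s = D / (j + 2) := by rw [hs]; field_simp; ring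
      have hsD' : 0 ≤ D - s := by rw [hsD]; positivity
      have hsD2 : D - s < R / 2 := by
        rw [hsD, div_lt_iff₀ hj]; linarith
      have hs2 : s < (j + 1) * (R / 2) := by
        rw [hs, div_lt_iff₀ hj]
        have : (0 : ℝ) < j + 1 := by positivity
        nlinarith
      have hsm : s ∈ Set.Icc 0 D := ⟨hs0, by linarith⟩
      have hxw : dist x (γ s) = s := by
        rw [← h0, hγ 0 ⟨le_rfl, hD0⟩ s hsm, zero_sub, abs_neg, abs_of_nonneg hs0]
      have hwz : dist z (γ s) = D - s := by
        conv_lhs => rw [← h1]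
        rw [hγ D ⟨hD0, le_rfl⟩ s hsm, abs_of_nonneg hsD']
      obtain ⟨y, hy, hyw⟩ := Set.mem_iUnion₂.1 (hcov (Metric.mem_ball'.2 (hxw.trans_lt hs2)))
      have hzy : z ∈ Metric.ball y R := by
        have := dist_triangle z (γ s) y
        have hyw : dist (γ s) y < R / 2 := hyw
        rw [Metric.mem_ball]
        linarith
      obtain ⟨y', hy', hzy'⟩ := Set.mem_iUnion₂.1 (hScov y hzy)
      exact Set.mem_iUnion₂.2 ⟨y', Finset.mem_biUnion.2 ⟨y, hy, hy'⟩, hzy'⟩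

/-! ### Sums over separated landmarks -/

/-- If balls grow at most geometrically with ratio `N` in steps of `R / 2`, then a sum of
exponentials over `2R`-separated points is dominated by its first term as soon as the exponential
decays twice as fast as the balls grow. -/
theorem sum_exp_le {M : Type*} [MetricSpace M] {l N : ℕ} {R lam : ℝ} (hR : 0 < R) (hlam : 0 < lam)
    {L : Fin l → M} (hL : ∀ a b, a ≠ b → 2 * R ≤ dist (L a) (L b)) {x : M}
    (hcov : ∀ j : ℕ, ∃ T : Finset M, T.card ≤ N ^ j ∧
      Metric.ball x ((j + 1) * (R / 2)) ⊆ ⋃ y ∈ T, Metric.ball y (R / 2))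
    (hN : N * Real.exp (-(R / 2) / lam) ≤ 1 / 2) {s : ℝ} (hs : s ≤ 2 * R) :
    ∑ a with s ≤ dist x (L a), Real.exp (-dist x (L a) / lam) ≤
      2 * N ^ 4 * Real.exp (-s / lam) := by
  classical
  have : Nonempty M := ⟨x⟩
  set τ := Real.exp (-(R / 2) / lam) with hτ
  have hτ0 : 0 ≤ τ := (Real.exp_pos _).le
  have card_le : ∀ j : ℕ,
      (Finset.univ.filter fun a => dist x (L a) < (j + 1) * (R / 2)).card ≤ N ^ j := by
    intro j
    obtain ⟨T, hT, hc⟩ := hcov j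
    have hf : ∀ a, dist x (L a) < (j + 1) * (R / 2) → ∃ y ∈ T, L a ∈ Metric.ball y (R / 2) := by
      intro a ha
      simpa using hc (Metric.mem_ball'.2 ha)
    choose! f hfT hf using hf
    refine (Finset.card_le_card_of_injOn f (fun a ha => hfT a (by simpa using ha)) ?_).trans hT
    intro a ha b hb hab
    by_contra hne
    have h1 := hf a (by simpa using ha)
    have h2 := hf b (by simpa using hb)
    rw [← hab] at h2
    have := hL a b hne
    have := dist_triangle_right (L a) (L b) (f a)
    rw [Metric.mem_ball] at h1 h2
    linarith
  set g : Fin l → ℕ := fun a => ⌊(dist x (L a) - s) / (R / 2)⌋₊ with hg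
  set S := Finset.univ.filter fun a => s ≤ dist x (L a) with hS
  have hterm : ∀ a ∈ S, Real.exp (-dist x (L a) / lam) ≤ Real.exp (-s / lam) * τ ^ g a := by
    intro a ha
    have ha : s ≤ dist x (L a) := by simpa [hS] using ha
    rw [hτ, ← Real.exp_nat_mul, ← Real.exp_add]
    apply Real.exp_le_exp.2
    have := Nat.floor_le (a := (dist x (L a) - s) / (R / 2))
      (div_nonneg (sub_nonneg.2 ha) (by positivity))
    rw [le_div_iff₀ (by positivity)] at this
    rw [mul_div_assoc', ← add_div]
    gcongr
    simp only [hg]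
    linarith
  have hfib : ∀ j : ℕ, (S.filter fun a => g a = j).card ≤ N ^ (j + 4) := by
    intro j
    refine (Finset.card_le_card fun a ha => ?_).trans (card_le (j + 4))
    simp only [Finset.mem_filter, Finset.mem_univ, true_and]
    have hj := (Finset.mem_filter.1 ha).2
    have := Nat.lt_floor_add_one ((dist x (L a) - s) / (R / 2))
    have e : ⌊(dist x (L a) - s) / (R / 2)⌋₊ = j := hj
    rw [e, div_lt_iff₀ (by positivity)] at this
    push_cast
    linarith
  set m := S.sup g + 1
  have hmaps : ∀ a ∈ S, g a ∈ Finset.range m := fun a ha =>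
    Finset.mem_range.2 (Nat.lt_succ_of_le (Finset.le_sup ha))
  have hτsum : ∑ a ∈ S, τ ^ g a ≤ 2 * N ^ 4 := by
    rw [← Finset.sum_fiberwise_of_maps_to hmaps]
    calc ∑ j ∈ Finset.range m, ∑ a ∈ S with g a = j, τ ^ g a
        ≤ ∑ j ∈ Finset.range m, (N : ℝ) ^ 4 * (1 / 2) ^ j := by
          refine Finset.sum_le_sum fun j _ => ?_
          rw [Finset.sum_congr rfl fun a ha => by rw [(Finset.mem_filter.1 ha).2],
            Finset.sum_const, nsmul_eq_mul]
          calc ((S.filter fun a => g a = j).card : ℝ) * τ ^ j ≤ (N : ℝ) ^ (j + 4) * τ ^ j := by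
                gcongr
                exact_mod_cast hfib j
            _ = N ^ 4 * (N * τ) ^ j := by rw [mul_pow]; ring
            _ ≤ N ^ 4 * (1 / 2) ^ j := by gcongr
      _ ≤ 2 * N ^ 4 := by
          rw [← Finset.mul_sum, mul_comm]
          gcongr
          exact sum_geometric_two_le m
  calc _ ≤ ∑ a ∈ S, Real.exp (-s / lam) * τ ^ g a := Finset.sum_le_sum hterm
    _ = Real.exp (-s / lam) * ∑ a ∈ S, τ ^ g a := by rw [Finset.mul_sum]
    _ ≤ Real.exp (-s / lam) * (2 * N ^ 4) := by gcongr
    _ = _ := mul_comm _ _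

/-! ### Inverting a perturbation of the identity -/

/-- A matrix with unit diagonal and small off-diagonal row sums is invertible, and its inverse is
close to the identity as a bilinear form, for the `ℓ¹` norm on the left and the `ℓ^∞` norm on the
right. -/
theorem dotProduct_inv_mulVec_le {l : ℕ} {A : Matrix (Fin l) (Fin l) ℝ} {ε : ℝ} (hε : ε ≤ 1 / 2)
    (hdiag : ∀ a, A a a = 1) (hrow : ∀ a, ∑ b ∈ Finset.univ.erase a, |A a b| ≤ ε) :
    IsUnit A.det ∧ ∀ u v : Fin l → ℝ, (∀ a, 0 ≤ u a) → (∀ a, |v a| ≤ 1) →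
      u ⬝ᵥ A⁻¹.mulVec v ≤ u ⬝ᵥ v + 2 * ε * ∑ a, u a := by
  have hdet : IsUnit A.det := by
    refine isUnit_iff_ne_zero.2 (det_ne_zero_of_sum_row_lt_diag fun a => ?_)
    simp only [Real.norm_eq_abs, hdiag, abs_one]
    linarith [hrow a]
  refine ⟨hdet, fun u v hu hv => ?_⟩
  rcases Nat.eq_zero_or_pos l with rfl | hl
  · simp
  have : Nonempty (Fin l) := ⟨⟨0, hl⟩⟩
  set w := A⁻¹.mulVec v with hw
  have hAw : A.mulVec w = v := by
    rw [hw, Matrix.mulVec_mulVec, Matrix.mul_nonsing_inv _ hdet, Matrix.one_mulVec]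
  have hsplit : ∀ a, w a = v a - ∑ b ∈ Finset.univ.erase a, A a b * w b := by
    intro a
    have := congrFun hAw a
    rw [Matrix.mulVec, dotProduct, ← Finset.add_sum_erase _ _ (Finset.mem_univ a), hdiag] at this
    linarith
  obtain ⟨a₀, -, ha₀⟩ := Finset.exists_max_image Finset.univ (fun a => |w a|)
    Finset.univ_nonempty
  have hoff : ∀ a, |∑ b ∈ Finset.univ.erase a, A a b * w b| ≤ ε * |w a₀| := by
    intro a
    calc |∑ b ∈ Finset.univ.erase a, A a b * w b|
        ≤ ∑ b ∈ Finset.univ.erase a, |A a b| * |w a₀| := by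
          refine (Finset.abs_sum_le_sum_abs _ _).trans (Finset.sum_le_sum fun b _ => ?_)
          rw [abs_mul]
          exact mul_le_mul_of_nonneg_left (ha₀ b (Finset.mem_univ b)) (abs_nonneg _)
      _ ≤ ε * |w a₀| := by
          rw [← Finset.sum_mul]
          exact mul_le_mul_of_nonneg_right (hrow a) (abs_nonneg _)
  have hε0 : 0 ≤ ε := (Finset.sum_nonneg fun _ _ => abs_nonneg _).trans (hrow a₀)
  have hw2 : |w a₀| ≤ 2 := by
    have h1 := hsplit a₀
    have h2 : |w a₀| ≤ |v a₀| + |∑ b ∈ Finset.univ.erase a₀, A a₀ b * w b| := by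
      conv_lhs => rw [h1]
      exact abs_sub _ _
    nlinarith [hoff a₀, hv a₀, abs_nonneg (w a₀)]
  have hwv : ∀ a, w a ≤ v a + 2 * ε := by
    intro a
    have h1 := hsplit a
    have h2 := neg_abs_le (∑ b ∈ Finset.univ.erase a, A a b * w b)
    nlinarith [hoff a]
  calc u ⬝ᵥ w = ∑ a, u a * w a := rfl
    _ ≤ ∑ a, (u a * v a + 2 * ε * u a) := Finset.sum_le_sum fun a _ => by
        nlinarith [hwv a, hu a, mul_le_mul_of_nonneg_left (hwv a) (hu a)]
    _ = u ⬝ᵥ v + 2 * ε * ∑ a, u a := by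
        rw [Finset.sum_add_distrib, Finset.mul_sum]; rfl

theorem nystrom_apply {M : Type*} [MetricSpace M] {ι κ : Type*} {l : ℕ} (lam : ℝ)
    (L : Fin l → M) (x : ι → M) (y : κ → M) (i : ι) (j : κ) :
    nystrom lam L x y i j = (fun a => Real.exp (-dist (x i) (L a) / lam)) ⬝ᵥ
      (kernelMatrix lam L L)⁻¹.mulVec fun a => Real.exp (-dist (y j) (L a) / lam) := by
  rw [nystrom, Matrix.mul_assoc, Matrix.mul_apply]
  simp only [dotProduct, Matrix.mulVec, Matrix.mul_apply, kernelMatrix, Matrix.of_apply,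
    dist_comm (L _) (y j)]

/-! ### Uniformity of a neighbor selected by distances -/

section Selection

variable {M : Type*} [MeasurableSpace M] {ν : Measure M} [IsProbabilityMeasure ν] {D : M → M → ℝ}
  {θ : Measure ℝ} {n : ℕ}

theorem pi_preimage_eq (hD : Measurable (Function.uncurry D)) (hθ : ∀ x, ν.map (D x) = θ) (x : M)
    {B : Set (Fin n → ℝ)} (hB : MeasurableSet B) :
    Measure.pi (fun _ : Fin n => ν) {z | (fun m => D x (z m)) ∈ B} =
      Measure.pi (fun _ : Fin n => θ) B := by
  have hDx : Measurable (D x) := hD.comp measurable_prodMk_left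
  have : IsProbabilityMeasure (ν.map (D x)) := Measure.isProbabilityMeasure_map hDx.aemeasurable
  have e := Measure.pi_map_pi (μ := fun _ : Fin n => ν) (f := fun _ => D x)
    fun _ => hDx.aemeasurable
  simp only [hθ] at e
  rw [← e, Measure.map_apply (by fun_prop) hB]
  rfl

/-- If the distribution of the distance to a point does not depend on the point, then an event that
is described by the distances from `x` to the sample is independent of `x`. -/
theorem prod_pi_fst_mem (hD : Measurable (Function.uncurry D)) (hθ : ∀ x, ν.map (D x) = θ)
    {B : Set (Fin n → ℝ)} (hB : MeasurableSet B) {S : Set M} (hS : MeasurableSet S) :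
    (ν.prod (Measure.pi fun _ : Fin n => ν))
        {p | p.1 ∈ S ∧ (fun m => D p.1 (p.2 m)) ∈ B} =
      ν S * Measure.pi (fun _ : Fin n => θ) B := by
  have hm : MeasurableSet {p : M × (Fin n → M) | p.1 ∈ S ∧ (fun m => D p.1 (p.2 m)) ∈ B} := by
    refine (measurable_fst hS).inter ?_
    have : Measurable fun p : M × (Fin n → M) => fun m => D p.1 (p.2 m) :=
      measurable_pi_lambda _ fun m =>
        hD.comp (measurable_fst.prodMk ((measurable_pi_apply m).comp measurable_snd))
    exact this hB
  rw [Measure.prod_apply hm, mul_comm, ← lintegral_indicator_const hS]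
  refine lintegral_congr fun x => ?_
  by_cases hx : x ∈ S
  · rw [Set.indicator_of_mem hx, ← pi_preimage_eq hD hθ x hB]
    congr 1
    ext z
    simp [hx]
  · rw [Set.indicator_of_notMem hx]
    simp [hx]

/-- If moreover the distance is symmetric, then an event that is described by the distances from `x`
to the sample is independent of each single sample point. -/
theorem prod_pi_apply_mem [IsProbabilityMeasure θ] (hD : Measurable (Function.uncurry D))
    (hsymm : ∀ x y, D x y = D y x)
    (hθ : ∀ x, ν.map (D x) = θ) {B : Set (Fin (n + 1) → ℝ)} (hB : MeasurableSet B)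
    (j : Fin (n + 1)) {S : Set M} (hS : MeasurableSet S) :
    (ν.prod (Measure.pi fun _ : Fin (n + 1) => ν))
        {p | p.2 j ∈ S ∧ (fun m => D p.1 (p.2 m)) ∈ B} =
      ν S * Measure.pi (fun _ : Fin (n + 1) => θ) B := by
  have hvec : Measurable fun p : M × (Fin (n + 1) → M) => fun m => D p.1 (p.2 m) :=
    measurable_pi_lambda _ fun m =>
      hD.comp (measurable_fst.prodMk ((measurable_pi_apply m).comp measurable_snd))
  have hm : MeasurableSet
      {p : M × (Fin (n + 1) → M) | p.2 j ∈ S ∧ (fun m => D p.1 (p.2 m)) ∈ B} :=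
    (((measurable_pi_apply j).comp measurable_snd) hS).inter (hvec hB)
  set B' : Set (ℝ × (Fin n → ℝ)) := {q | j.insertNth (α := fun _ => ℝ) q.1 q.2 ∈ B} with hB'
  have hB'm : MeasurableSet B' :=
    (MeasurableEquiv.piFinSuccAbove (fun _ => ℝ) j).symm.measurable hB
  have hθsplit : Measure.pi (fun _ : Fin (n + 1) => θ) B =
      (θ.prod (Measure.pi fun _ : Fin n => θ)) B' := by
    rw [← ((measurePreserving_piFinSuccAbove (fun _ : Fin (n + 1) => θ) j).symm _).measure_preimage
      hB.nullMeasurableSet]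
    rfl
  -- the probability of the event if the distance to the selected point is `r`
  set q : ℝ → ENNReal := fun r => Measure.pi (fun _ : Fin n => θ) (Prod.mk r ⁻¹' B') with hq
  have hqm : Measurable q := measurable_measure_prodMk_left hB'm
  have inner : ∀ x, (Measure.pi fun _ : Fin (n + 1) => ν)
      {z | z j ∈ S ∧ (fun m => D x (z m)) ∈ B} = ∫⁻ y, S.indicator (fun y => q (D x y)) y ∂ν := by
    intro x
    have hmx : MeasurableSet {z : Fin (n + 1) → M | z j ∈ S ∧ (fun m => D x (z m)) ∈ B} :=
      measurable_prodMk_left hm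
    rw [← ((measurePreserving_piFinSuccAbove (fun _ : Fin (n + 1) => ν) j).symm _).measure_preimage
      hmx.nullMeasurableSet, Measure.prod_apply
        ((MeasurableEquiv.piFinSuccAbove (fun _ => M) j).symm.measurable hmx)]
    refine lintegral_congr fun y => ?_
    have hcomp : ∀ z : Fin n → M, (fun m => D x (j.insertNth (α := fun _ => M) y z m)) =
        j.insertNth (α := fun _ => ℝ) (D x y) fun m => D x (z m) := by
      intro z
      refine (Fin.eq_insertNth_iff (α := fun _ => ℝ)).2 ⟨by simp, ?_⟩
      ext m
      simp [Fin.removeNth]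
    have hset : Prod.mk y ⁻¹' (⇑(MeasurableEquiv.piFinSuccAbove (fun _ => M) j).symm ⁻¹'
        {z : Fin (n + 1) → M | z j ∈ S ∧ (fun m => D x (z m)) ∈ B}) =
        {z : Fin n → M | y ∈ S ∧ (fun m => D x (z m)) ∈ Prod.mk (D x y) ⁻¹' B'} := by
      ext z
      show (j.insertNth (α := fun _ => M) y z j ∈ S ∧
        (fun m => D x (j.insertNth (α := fun _ => M) y z m)) ∈ B) ↔ _
      rw [hcomp, Fin.insertNth_apply_same]
      rfl
    rw [hset]
    by_cases hy : y ∈ S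
    · rw [Set.indicator_of_mem hy]
      show _ = Measure.pi (fun _ : Fin n => θ) (Prod.mk (D x y) ⁻¹' B')
      rw [← pi_preimage_eq hD hθ x (measurable_prodMk_left hB'm)]
      simp [hy]
    · rw [Set.indicator_of_notMem hy]
      simp [hy]
  have hqD : Measurable (fun p : M × M => q (D p.1 p.2)) := hqm.comp hD
  rw [Measure.prod_apply hm]
  calc _ = ∫⁻ x, ∫⁻ y, S.indicator (fun y => q (D x y)) y ∂ν ∂ν := lintegral_congr inner
    _ = ∫⁻ y, ∫⁻ x, S.indicator (fun y => q (D x y)) y ∂ν ∂ν := by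
      refine lintegral_lintegral_swap (Measurable.aemeasurable ?_)
      exact (hqD.indicator (measurable_snd hS))
    _ = ∫⁻ y, S.indicator (fun _ => ∫⁻ r, q r ∂θ) y ∂ν := by
      refine lintegral_congr fun y => ?_
      by_cases hy : y ∈ S
      · have hDy : Measurable (D y) := hD.comp measurable_prodMk_left
        simp only [Set.indicator_of_mem hy, fun x => hsymm x y]
        rw [← hθ y, lintegral_map hqm hDy]
      · simp only [Set.indicator_of_notMem hy, lintegral_zero]
    _ = _ := by
      rw [lintegral_indicator_const hS, hθsplit, Measure.prod_apply hB'm, mul_comm]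

/-- Independent real random variables whose law has no atoms below `R` have no ties below `R`. -/
theorem pi_tie_eq_zero [IsProbabilityMeasure θ] {R : ℝ} (hat : ∀ r < R, θ {r} = 0) {j m : Fin (n + 1)}
    (hjm : j ≠ m) :
    Measure.pi (fun _ : Fin (n + 1) => θ) {s | s j = s m ∧ s m < R} = 0 := by
  obtain ⟨m, rfl⟩ := Fin.exists_succAbove_eq hjm.symm
  have hm : MeasurableSet {s : Fin (n + 1) → ℝ | s j = s (j.succAbove m) ∧ s (j.succAbove m) < R} :=
    (measurableSet_eq_fun (measurable_pi_apply j) (measurable_pi_apply (j.succAbove m))).inter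
      (measurableSet_lt (measurable_pi_apply (j.succAbove m)) measurable_const)
  rw [← ((measurePreserving_piFinSuccAbove (fun _ : Fin (n + 1) => θ) j).symm _).measure_preimage
      hm.nullMeasurableSet, Measure.prod_apply_symm
        ((MeasurableEquiv.piFinSuccAbove (fun _ => ℝ) j).symm.measurable hm)]
  refine (lintegral_congr fun s => ?_).trans lintegral_zero
  have hset : (fun r => (r, s)) ⁻¹' (⇑(MeasurableEquiv.piFinSuccAbove (fun _ => ℝ) j).symm ⁻¹'
        {s : Fin (n + 1) → ℝ | s j = s (j.succAbove m) ∧ s (j.succAbove m) < R}) =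
        {r | r = s m ∧ s m < R} := by
      ext r
      show (j.insertNth (α := fun _ => ℝ) r s j =
          j.insertNth (α := fun _ => ℝ) r s (j.succAbove m) ∧
        j.insertNth (α := fun _ => ℝ) r s (j.succAbove m) < R) ↔ _
      rw [Fin.insertNth_apply_same, Fin.insertNth_apply_succAbove]
      rfl
  rw [hset]
  by_cases h : s m < R
  · simpa [h] using hat _ h
  · simp [h]

end Selection

theorem setIntegral_comp_eq_of_measure_eq {Ω M : Type*} [MeasurableSpace Ω] [MeasurableSpace M]
    {P : Measure Ω} {ν : Measure M} {X : Ω → M} (hX : Measurable X) {A : Set Ω} {Q : ENNReal}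
    (h : ∀ S, MeasurableSet S → P (X ⁻¹' S ∩ A) = ν S * Q) {f : M → ℝ} (hf : Measurable f) :
    ∫ ω in A, f (X ω) ∂P = Q.toReal * ∫ x, f x ∂ν := by
  have e : (P.restrict A).map X = Q • ν := by
    ext S hS
    rw [Measure.map_apply hX hS, Measure.restrict_apply (hX hS), h S hS]
    simp [mul_comm]
  rw [← integral_map hX.aemeasurable hf.aestronglyMeasurable, e, integral_smul_measure,
    smul_eq_mul]

/-! ### Nearest neighbors -/

theorem kthNearestDist_eq {M : Type*} [MetricSpace M] {n k : ℕ} {x : M} {y : Fin n → M} {j : Fin n}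
    (h : IsKthNearest k x y j) : kthNearestDist k x y = dist x (y j) := by
  have hleast : IsLeast {r : ℝ | k ≤ (Finset.univ.filter fun j => dist x (y j) ≤ r).card}
      (dist x (y j)) := by
    refine ⟨h.2, fun r hr => ?_⟩
    by_contra! hlt
    have hr : k ≤ (Finset.univ.filter fun j => dist x (y j) ≤ r).card := hr
    refine absurd (hr.trans (Finset.card_le_card fun m hm => ?_)) (not_le.2 h.1)
    simp only [Finset.mem_filter, Finset.mem_univ, true_and] at hm ⊢
    linarith
  exact hleast.csInf_eq

/-- The vectors of distances, truncated at `R`, for which the `j`-th point is a `k`-th nearest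
neighbor at a distance less than `R`. -/
def kthNearestSet (k n : ℕ) (R : ℝ) (j : Fin n) : Set (Fin n → ℝ) :=
  {s | s j < R ∧ (Finset.univ.filter fun m => s m < s j).card < k ∧
    k ≤ (Finset.univ.filter fun m => s m ≤ s j).card}

theorem mem_kthNearestSet_iff {M : Type*} [MetricSpace M] {n k : ℕ} {R : ℝ} {x : M}
    {y : Fin n → M} {j : Fin n} :
    (fun m => min (dist x (y m)) R) ∈ kthNearestSet k n R j ↔
      dist x (y j) < R ∧ IsKthNearest k x y j := by
  have h1 : min (dist x (y j)) R < R ↔ dist x (y j) < R := by simp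
  simp only [kthNearestSet, Set.mem_ofPred_eq, h1, IsKthNearest]
  refine and_congr_right fun hj => ?_
  rw [min_eq_left hj.le]
  have h2 : ∀ m, min (dist x (y m)) R < dist x (y j) ↔ dist x (y m) < dist x (y j) := by
    intro m; rw [min_lt_iff]; simp [hj.le]
  have h3 : ∀ m, min (dist x (y m)) R ≤ dist x (y j) ↔ dist x (y m) ≤ dist x (y j) := by
    intro m; rw [min_le_iff]; simp [hj]
  simp only [h2, h3]

theorem measurableSet_kthNearestSet (k n : ℕ) (R : ℝ) (j : Fin n) :
    MeasurableSet (kthNearestSet k n R j) := by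
  classical
  have hc : ∀ p : (Fin n → ℝ) → Fin n → Prop, (∀ m, MeasurableSet {s | p s m}) →
      Measurable fun s => (Finset.univ.filter fun m => p s m).card := by
    intro p hp
    simp only [Finset.card_filter]
    exact Finset.measurable_sum _ fun m _ => Measurable.ite (hp m) measurable_const measurable_const
  have hlt := hc (fun s m => s m < s j) fun m =>
    measurableSet_lt (measurable_pi_apply m) (measurable_pi_apply j)
  have hle := hc (fun s m => s m ≤ s j) fun m =>
    measurableSet_le (measurable_pi_apply m) (measurable_pi_apply j)
  have h1 : MeasurableSet {s : Fin n → ℝ | (Finset.univ.filter fun m => s m < s j).card < k} := by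
    convert measurableSet_lt hlt (measurable_const (a := k))
  have h2 : MeasurableSet {s : Fin n → ℝ | k ≤ (Finset.univ.filter fun m => s m ≤ s j).card} := by
    convert measurableSet_le (measurable_const (a := k)) hle
  have h0 : MeasurableSet {s : Fin n → ℝ | s j < R} :=
    measurableSet_lt (measurable_pi_apply j) measurable_const
  exact h0.inter (h1.inter h2)

/-! ### The expectation over a point and its nearest neighbor -/

/-- A point and its `k`-th nearest neighbor in an independent sample: an integrand that is at most
the mean `(h x + h y) / 2` if they are closer than `R`, and at most `G` otherwise, has expectation
at most `G + ε` if `∫ h ≤ G + ε`. Both points are uniform given that they are closer than `R`,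
because the truncated distances to `x` have the same law `θ` for every `x`. -/
theorem integral_le_of_kthNearest {M Ω : Type*} [MetricSpace M] [CompactSpace M]
    [MeasurableSpace M] [BorelSpace M] [MeasurableSpace Ω] {P : Measure Ω}
    [IsProbabilityMeasure P] {ν : Measure M} [IsProbabilityMeasure ν] {θ : Measure ℝ}
    [IsProbabilityMeasure θ] {n k : ℕ} {R : ℝ}
    (hθ : ∀ x, ν.map (fun y => min (dist x y) R) = θ) (hat : ∀ r < R, θ {r} = 0)
    {X : Ω → M} {Y : Fin n → Ω → M} (hX : Measurable X) (hY : ∀ j, Measurable (Y j))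
    (hlaw : P.map (fun ω => (X ω, fun j => Y j ω)) = ν.prod (Measure.pi fun _ : Fin n => ν))
    {ik : Ω → Fin n} (hik : ∀ᵐ ω ∂P, IsKthNearest k (X ω) (fun j => Y j ω) (ik ω))
    {h : M → ℝ} (hh : Measurable h) {C : ℝ} (hC : ∀ x, |h x| ≤ C) {F : Ω → ℝ}
    (hF : Integrable F P) {G ε : ℝ} (hε : 0 ≤ ε) (hν : ∫ x, h x ∂ν ≤ G + ε)
    (hnear : ∀ ω, dist (X ω) (Y (ik ω) ω) < R → F ω ≤ (h (X ω) + h (Y (ik ω) ω)) / 2)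
    (hfar : ∀ ω, R ≤ dist (X ω) (Y (ik ω) ω) → F ω ≤ G) :
    ∫ ω, F ω ∂P ≤ G + ε := by
  classical
  obtain _ | n := n
  · obtain ⟨ω⟩ := P.nonempty_of_neZero
    exact (ik ω).elim0
  set D : M → M → ℝ := fun x y => min (dist x y) R with hDdef
  have hD : Measurable (Function.uncurry D) :=
    (measurable_fst.dist measurable_snd).min measurable_const
  have hsymm : ∀ x y, D x y = D y x := fun x y => by simp only [hDdef, dist_comm]
  set V : Ω → Fin (n + 1) → ℝ := fun ω m => D (X ω) (Y m ω) with hV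
  have hVm : Measurable V := measurable_pi_lambda _ fun m => hD.comp (hX.prodMk (hY m))
  have hXY : Measurable fun ω => (X ω, fun j => Y j ω) := hX.prodMk (measurable_pi_lambda _ hY)
  have hvec : Measurable fun p : M × (Fin (n + 1) → M) => fun m => D p.1 (p.2 m) :=
    measurable_pi_lambda _ fun m =>
      hD.comp (measurable_fst.prodMk ((measurable_pi_apply m).comp measurable_snd))
  have lawX : ∀ B, MeasurableSet B → ∀ S, MeasurableSet S →
      P (X ⁻¹' S ∩ V ⁻¹' B) = ν S * Measure.pi (fun _ => θ) B := by
    intro B hB S hS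
    rw [← prod_pi_fst_mem hD hθ hB hS, ← hlaw]
    exact (Measure.map_apply hXY ((measurable_fst hS).inter (hvec hB))).symm
  have lawY : ∀ j, ∀ B, MeasurableSet B → ∀ S, MeasurableSet S →
      P (Y j ⁻¹' S ∩ V ⁻¹' B) = ν S * Measure.pi (fun _ => θ) B := by
    intro j B hB S hS
    rw [← prod_pi_apply_mem hD hsymm hθ hB j hS, ← hlaw]
    exact (Measure.map_apply hXY
      ((((measurable_pi_apply j).comp measurable_snd) hS).inter (hvec hB))).symm
  set W : Fin (n + 1) → Set Ω := fun j => V ⁻¹' kthNearestSet k (n + 1) R j with hW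
  have hWm : ∀ j, MeasurableSet (W j) := fun j => hVm (measurableSet_kthNearestSet k (n + 1) R j)
  have hWiff : ∀ j ω, ω ∈ W j ↔ dist (X ω) (Y j ω) < R ∧
      IsKthNearest k (X ω) (fun j => Y j ω) j := fun j ω =>
    mem_kthNearestSet_iff (x := X ω) (y := fun j => Y j ω)
  have ties : ∀ᵐ ω ∂P, ∀ j m, j ≠ m → ¬ (V ω j = V ω m ∧ V ω m < R) := by
    refine ae_all_iff.2 fun j => ae_all_iff.2 fun m => ?_
    by_cases hjm : j = m
    · exact Filter.Eventually.of_forall fun _ h => absurd hjm h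
    have hm : MeasurableSet {s : Fin (n + 1) → ℝ | s j = s m ∧ s m < R} :=
      (measurableSet_eq_fun (measurable_pi_apply j) (measurable_pi_apply m)).inter
        (measurableSet_lt (measurable_pi_apply m) measurable_const)
    have h0 := lawX _ hm Set.univ MeasurableSet.univ
    rw [pi_tie_eq_zero hat hjm, mul_zero, Set.preimage_univ, Set.univ_inter] at h0
    refine (measure_eq_zero_iff_ae_notMem.1 h0).mono fun ω hω _ => hω
  -- below `R` there is exactly one `k`-th nearest neighbor
  have hWsum : ∀ᵐ ω ∂P, ∀ f : Fin (n + 1) → ℝ, ∑ j, (W j).indicator (fun _ => f j) ω =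
      if dist (X ω) (Y (ik ω) ω) < R then f (ik ω) else 0 := by
    filter_upwards [ties, hik] with ω hties hω f
    have key : ∀ j, ω ∈ W j → dist (X ω) (Y (ik ω) ω) < R ∧ j = ik ω := by
      intro j hj
      obtain ⟨h1, h2⟩ := (hWiff j ω).1 hj
      have e : dist (X ω) (Y j ω) = dist (X ω) (Y (ik ω) ω) :=
        (kthNearestDist_eq h2).symm.trans (kthNearestDist_eq hω)
      refine ⟨e ▸ h1, ?_⟩
      by_contra hne
      refine hties j (ik ω) hne ⟨?_, ?_⟩
      · simp only [hV, hDdef, e]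
      · simp only [hV, hDdef]
        exact min_lt_of_left_lt (e ▸ h1)
    split_ifs with hlt
    · have hmem : ω ∈ W (ik ω) := (hWiff _ ω).2 ⟨hlt, hω⟩
      rw [Finset.sum_eq_single (ik ω), Set.indicator_of_mem hmem]
      · intro j _ hj
        exact Set.indicator_of_notMem (fun hm => hj (key j hm).2) _
      · simp
    · exact Finset.sum_eq_zero fun j _ => Set.indicator_of_notMem (fun hm => hlt (key j hm).1) _
  set Q : Fin (n + 1) → ENNReal := fun j =>
    Measure.pi (fun _ => θ) (kthNearestSet k (n + 1) R j) with hQ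
  have hQsum : ∑ j, (Q j).toReal ≤ 1 := by
    have e : ∀ j, (Q j).toReal = ∫ ω, (W j).indicator (fun _ => (1 : ℝ)) ω ∂P := by
      intro j
      have := lawX _ (measurableSet_kthNearestSet k (n + 1) R j) Set.univ MeasurableSet.univ
      rw [Set.preimage_univ, Set.univ_inter, measure_univ, one_mul] at this
      rw [integral_indicator_const _ (hWm j), smul_eq_mul, mul_one, Measure.real, this]
    simp only [e]
    rw [← integral_finsetSum _ fun j _ => (integrable_const (1 : ℝ)).indicator (hWm j)]
    calc _ ≤ ∫ _, (1 : ℝ) ∂P := by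
          refine integral_mono_ae
            (integrable_finsetSum _ fun j _ => (integrable_const (1 : ℝ)).indicator (hWm j))
            (integrable_const _) ?_
          filter_upwards [hWsum] with ω hω
          show ∑ j, (W j).indicator (fun _ => (1 : ℝ)) ω ≤ 1
          rw [hω fun _ => 1]
          split_ifs <;> norm_num
      _ = 1 := by simp
  have hbdd : ∀ Z : Ω → M, Measurable Z → Integrable (fun ω => h (Z ω) - G) P := fun Z hZ =>
    (Integrable.of_bound (hh.comp hZ).aestronglyMeasurable C
      (Filter.Eventually.of_forall fun ω => hC (Z ω))).sub (integrable_const _)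
  have hhν : Integrable h ν := Integrable.of_bound hh.aestronglyMeasurable C
    (Filter.Eventually.of_forall hC)
  have hint : ∀ j, Integrable
      ((W j).indicator fun ω => ((h (X ω) - G) + (h (Y j ω) - G)) / 2) P := fun j =>
    (((hbdd X hX).add (hbdd (Y j) (hY j))).div_const 2).indicator (hWm j)
  have hval : ∀ j, ∫ ω, (W j).indicator (fun ω => ((h (X ω) - G) + (h (Y j ω) - G)) / 2) ω ∂P =
      (Q j).toReal * (∫ x, h x ∂ν - G) := by
    intro j
    have hB := measurableSet_kthNearestSet k (n + 1) R j
    have hf : Measurable fun x => h x - G := hh.sub measurable_const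
    have e : ∫ x, (h x - G) ∂ν = ∫ x, h x ∂ν - G := by
      rw [integral_sub hhν (integrable_const _)]; simp
    rw [integral_indicator (hWm j), integral_div, integral_add (hbdd X hX).integrableOn
      (hbdd (Y j) (hY j)).integrableOn,
      setIntegral_comp_eq_of_measure_eq hX (lawX _ hB) hf,
      setIntegral_comp_eq_of_measure_eq (hY j) (lawY j _ hB) hf, e]
    ring
  calc ∫ ω, F ω ∂P
      ≤ ∫ ω, (G + ∑ j, (W j).indicator
          (fun ω => ((h (X ω) - G) + (h (Y j ω) - G)) / 2) ω) ∂P := by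
        refine integral_mono_ae hF
          ((integrable_const G).add (integrable_finsetSum _ fun j _ => hint j)) ?_
        filter_upwards [hWsum] with ω hω
        have e : ∑ j, (W j).indicator (fun ω => ((h (X ω) - G) + (h (Y j ω) - G)) / 2) ω =
            if dist (X ω) (Y (ik ω) ω) < R then
              ((h (X ω) - G) + (h (Y (ik ω) ω) - G)) / 2 else 0 := by
          rw [← hω fun j => ((h (X ω) - G) + (h (Y j ω) - G)) / 2]
          rfl
        rw [e]
        split_ifs with hlt
        · linarith [hnear ω hlt]
        · linarith [hfar ω (not_lt.1 hlt)]
    _ = G + ∑ j, (Q j).toReal * (∫ x, h x ∂ν - G) := by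
        rw [integral_add (integrable_const G) (integrable_finsetSum _ fun j _ => hint j),
          integral_finsetSum _ fun j _ => hint j, Finset.sum_congr rfl fun j _ => hval j]
        simp
    _ ≤ G + ∑ j, (Q j).toReal * ε := by
        gcongr
        linarith
    _ ≤ G + ε := by
        rw [← Finset.sum_mul]
        nlinarith

/-! ### The uniform law on a manifold that is Euclidean at the scale `R` -/

section Uniform

variable {d : ℕ} {M : Type*} [MetricSpace M] [MeasurableSpace M] [BorelSpace M] {R : ℝ}

theorem isAddHaarMeasure_hausdorffMeasure_euclideanSpace (d : ℕ) :
    (Measure.hausdorffMeasure (d : ℝ) :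
      Measure (EuclideanSpace ℝ (Fin d))).IsAddHaarMeasure := by
  simpa using isAddHaarMeasure_hausdorffMeasure (E := EuclideanSpace ℝ (Fin d))

theorem map_min_dist_eq {ν : Measure M} [IsProbabilityMeasure ν] {c : ENNReal}
    (hν : ν = c • Measure.hausdorffMeasure (d : ℝ)) (hball : ∀ x : M, IsEuclideanBall d x R)
    (x x' : M) : ν.map (fun y => min (dist x y) R) = ν.map (fun y => min (dist x' y) R) := by
  have hm : ∀ x : M, Measurable fun y => min (dist x y) R := fun x =>
    ((continuous_const.dist continuous_id).min continuous_const).measurable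
  have hval : ∀ (x : M) (t : ℝ), t < R → ν.map (fun y => min (dist x y) R) (Set.Iic t) =
      c * ((Measure.hausdorffMeasure (d : ℝ)).restrict
        (Metric.ball (0 : EuclideanSpace ℝ (Fin d)) R)).map norm (Set.Iic t) := by
    intro x t ht
    have hdm : Measurable (dist x) := (continuous_const.dist continuous_id).measurable
    rw [← (hball x).map_dist, Measure.map_apply (hm x) measurableSet_Iic,
      Measure.map_apply hdm measurableSet_Iic, Measure.restrict_apply (hdm measurableSet_Iic), hν,
      Measure.smul_apply, smul_eq_mul]
    congr 2
    ext y
    simp only [Set.mem_preimage, Set.mem_Iic, min_le_iff, not_le.2 ht, or_false, Set.mem_inter_iff,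
      Metric.mem_ball']
    exact ⟨fun h => ⟨h, h.trans_lt ht⟩, fun h => h.1⟩
  have : IsProbabilityMeasure (ν.map fun y => min (dist x y) R) :=
    Measure.isProbabilityMeasure_map (hm x).aemeasurable
  refine Measure.ext_of_Iic _ _ fun t => ?_
  by_cases ht : t < R
  · rw [hval x t ht, hval x' t ht]
  · have huniv : ∀ x : M, (fun y => min (dist x y) R) ⁻¹' Set.Iic t = Set.univ := by
      intro x
      ext y
      simp [not_lt.1 ht]
    rw [Measure.map_apply (hm x) measurableSet_Iic, Measure.map_apply (hm x') measurableSet_Iic,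
      huniv, huniv]

theorem map_min_dist_singleton (hd : 1 ≤ d) {ν : Measure M} {c : ENNReal}
    (hν : ν = c • Measure.hausdorffMeasure (d : ℝ)) {x : M} (hball : IsEuclideanBall d x R)
    {r : ℝ} (hr : r < R) : ν.map (fun y => min (dist x y) R) {r} = 0 := by
  have hm : Measurable fun y => min (dist x y) R :=
    ((continuous_const.dist continuous_id).min continuous_const).measurable
  have hdm : Measurable (dist x) := (continuous_const.dist continuous_id).measurable
  have := isAddHaarMeasure_hausdorffMeasure_euclideanSpace d
  have : Nonempty (Fin d) := ⟨⟨0, hd⟩⟩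
  have h0 : ((Measure.hausdorffMeasure (d : ℝ)).restrict
        (Metric.ball (0 : EuclideanSpace ℝ (Fin d)) R)).map norm {r} = 0 := by
    rw [Measure.map_apply measurable_norm (measurableSet_singleton r)]
    refine le_antisymm ((Measure.restrict_apply_le _ _).trans ?_) bot_le
    rw [← Measure.addHaar_sphere (Measure.hausdorffMeasure (d : ℝ))
      (0 : EuclideanSpace ℝ (Fin d)) r]
    exact measure_mono fun v hv => by simpa using hv
  rw [← hball.map_dist, Measure.map_apply hdm (measurableSet_singleton r),
    Measure.restrict_apply (hdm (measurableSet_singleton r))] at h0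
  rw [Measure.map_apply hm (measurableSet_singleton r), hν, Measure.smul_apply, smul_eq_mul]
  refine mul_eq_zero_of_right _ (le_antisymm ((measure_mono fun y hy => ?_).trans h0.le) bot_le)
  have hy : min (dist x y) R = r := hy
  rcases min_choice (dist x y) R with h | h
  · have e : dist x y = r := by rw [← hy, h]
    exact ⟨e, Metric.mem_ball'.2 (e ▸ hr)⟩
  · exact absurd (h.symm.trans hy) hr.ne'

/-- The integral of `exp (-2 ‖v‖ / lam)` over the Euclidean ball of radius `R`, in polar
coordinates. -/
theorem setIntegral_exp_norm (hd : 1 ≤ d) {lam : ℝ} (hR : 0 < R) (hlam : 0 < lam) :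
    ∫ v in Metric.ball (0 : EuclideanSpace ℝ (Fin d)) R, Real.exp (-(2 * ‖v‖) / lam)
      ∂(Measure.hausdorffMeasure (d : ℝ)) =
    (Measure.hausdorffMeasure (d : ℝ)).real (Metric.ball (0 : EuclideanSpace ℝ (Fin d)) R) *
      (d * (∫ t in (0 : ℝ)..(2 * R / lam), t ^ (d - 1) * Real.exp (-t)) /
        (2 * R / lam) ^ d) := by
  have := isAddHaarMeasure_hausdorffMeasure_euclideanSpace d
  have : Nonempty (Fin d) := ⟨⟨0, hd⟩⟩
  set μ : Measure (EuclideanSpace ℝ (Fin d)) := Measure.hausdorffMeasure (d : ℝ) with hμ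
  have e1 : ∫ v in Metric.ball (0 : EuclideanSpace ℝ (Fin d)) R, Real.exp (-(2 * ‖v‖) / lam) ∂μ =
      ∫ v, (Set.Iio R).indicator (fun r => Real.exp (-(2 * r) / lam)) ‖v‖ ∂μ := by
    rw [← integral_indicator measurableSet_ball]
    congr 1
    ext v
    by_cases hv : ‖v‖ < R
    · rw [Set.indicator_of_mem (by simpa using hv), Set.indicator_of_mem (by simpa using hv)]
    · rw [Set.indicator_of_notMem (by simpa using hv), Set.indicator_of_notMem (by simpa using hv)]
  have e2 : ∫ y in Set.Ioi (0 : ℝ), y ^ (d - 1) •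
      (Set.Iio R).indicator (fun r => Real.exp (-(2 * r) / lam)) y =
      ∫ y in (0 : ℝ)..R, y ^ (d - 1) * Real.exp (-(2 * y) / lam) := by
    rw [intervalIntegral.integral_of_le hR.le, ← integral_Ioc_eq_integral_Ioo.symm,
      ← Set.Ioi_inter_Iio, ← setIntegral_indicator measurableSet_Iio]
    congr 1
    ext y
    by_cases hy : y ∈ Set.Iio R
    · simp [Set.indicator_of_mem hy]
    · simp [Set.indicator_of_notMem hy]
  have e3 : ∫ y in (0 : ℝ)..R, y ^ (d - 1) * Real.exp (-(2 * y) / lam) =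
      (lam / 2) ^ d * ∫ t in (0 : ℝ)..(2 * R / lam), t ^ (d - 1) * Real.exp (-t) := by
    have := intervalIntegral.integral_comp_mul_left (a := 0) (b := R)
      (fun t : ℝ => t ^ (d - 1) * Real.exp (-t)) (c := 2 / lam) (by positivity)
    rw [mul_zero, show 2 / lam * R = 2 * R / lam by ring, smul_eq_mul] at this
    rw [show (∫ t in (0 : ℝ)..(2 * R / lam), t ^ (d - 1) * Real.exp (-t)) = 2 / lam *
      ∫ y in (0 : ℝ)..R, (2 / lam * y) ^ (d - 1) * Real.exp (-(2 / lam * y)) by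
        rw [this]; field_simp, ← intervalIntegral.integral_const_mul,
        ← intervalIntegral.integral_const_mul]
    congr 1
    ext y
    obtain ⟨m, rfl⟩ := Nat.exists_eq_add_of_le hd
    rw [show -(2 / lam * y) = -(2 * y) / lam by ring, Nat.add_sub_cancel_left, mul_pow, pow_add]
    field_simp
    rw [div_pow, div_pow]
    field_simp
  have e4 : μ.real (Metric.ball 0 R) = R ^ d * μ.real (Metric.ball 0 1) := by
    rw [Measure.real, Measure.addHaar_ball μ _ hR.le, ENNReal.toReal_mul, ENNReal.toReal_ofReal
      (by positivity), finrank_euclideanSpace_fin]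
    rfl
  rw [e1, integral_fun_norm_addHaar, finrank_euclideanSpace_fin, e2, e3, e4, nsmul_eq_mul,
    smul_eq_mul, div_pow, div_pow, mul_pow]
  field_simp

theorem setIntegral_exp_dist (hd : 1 ≤ d) {ν : Measure M} {c : ENNReal}
    (hν : ν = c • Measure.hausdorffMeasure (d : ℝ)) {lam : ℝ} (hR : 0 < R) (hlam : 0 < lam)
    {x : M} (hball : IsEuclideanBall d x R) :
    ∫ y in Metric.ball x R, Real.exp (-(2 * dist x y) / lam) ∂ν =
      ν.real (Metric.ball x R) * (d * (∫ t in (0 : ℝ)..(2 * R / lam), t ^ (d - 1) * Real.exp (-t)) /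
        (2 * R / lam) ^ d) := by
  have hdm : Measurable (dist x) := (continuous_const.dist continuous_id).measurable
  have hfm : Measurable fun r : ℝ => Real.exp (-(2 * r) / lam) := by fun_prop
  have e1 : ∫ y in Metric.ball x R, Real.exp (-(2 * dist x y) / lam)
      ∂(Measure.hausdorffMeasure (d : ℝ)) =
      ∫ v in Metric.ball (0 : EuclideanSpace ℝ (Fin d)) R, Real.exp (-(2 * ‖v‖) / lam)
      ∂(Measure.hausdorffMeasure (d : ℝ)) := by
    rw [← integral_map (f := fun r : ℝ => Real.exp (-(2 * r) / lam)) hdm.aemeasurable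
      hfm.aestronglyMeasurable, hball.map_dist, integral_map measurable_norm.aemeasurable
      hfm.aestronglyMeasurable]
  have e2 : (Measure.hausdorffMeasure (d : ℝ)).real (Metric.ball x R) =
      (Measure.hausdorffMeasure (d : ℝ)).real (Metric.ball (0 : EuclideanSpace ℝ (Fin d)) R) := by
    have := congrArg (fun m => m Set.univ) hball.map_dist
    simp only [Measure.map_apply hdm MeasurableSet.univ, Measure.map_apply measurable_norm
      MeasurableSet.univ, Set.preimage_univ, Measure.restrict_apply_univ] at this
    rw [Measure.real, Measure.real, this]
  rw [hν, Measure.restrict_smul, integral_smul_measure, e1, setIntegral_exp_norm hd hR hlam,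
    measureReal_ennreal_smul_apply, smul_eq_mul, e2, mul_assoc]

end Uniform

/-! ### The leading term -/

theorem gamma_sub_upperGamma {d : ℕ} (hd : 1 ≤ d) {ρ : ℝ} (hρ : 0 ≤ ρ) :
    Real.Gamma d - upperGamma d ρ = ∫ t in (0 : ℝ)..ρ, t ^ (d - 1) * Real.exp (-t) := by
  have hd' : (0 : ℝ) < d := by exact_mod_cast hd
  have hint := Real.GammaIntegral_convergent hd'
  simp only [mul_comm (Real.exp _)] at hint
  rw [Real.Gamma_eq_integral hd', upperGamma]
  simp only [mul_comm (Real.exp _)]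
  rw [intervalIntegral.integral_Ioi_sub_Ioi hint hρ]
  congr 1
  ext t
  rw [← Nat.cast_one, ← Nat.cast_sub hd, Real.rpow_natCast]

theorem exp_neg_one_le_mul_integral {d : ℕ} (hd : 1 ≤ d) {ρ : ℝ} (hρ : 1 ≤ ρ) :
    Real.exp (-1) ≤ d * ∫ t in (0 : ℝ)..ρ, t ^ (d - 1) * Real.exp (-t) := by
  have hd' : (0 : ℝ) < d := by exact_mod_cast hd
  have hcont : Continuous fun t : ℝ => t ^ (d - 1) * Real.exp (-t) := by fun_prop
  have h1 : ∫ t in (0 : ℝ)..1, t ^ (d - 1) * Real.exp (-1) ≤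
      ∫ t in (0 : ℝ)..1, t ^ (d - 1) * Real.exp (-t) := by
    refine intervalIntegral.integral_mono_on zero_le_one
      (Continuous.intervalIntegrable (by fun_prop) _ _) (hcont.intervalIntegrable _ _) ?_
    intro t ht
    have := ht.1
    gcongr
    exact ht.2
  have h2 : ∫ t in (0 : ℝ)..1, t ^ (d - 1) * Real.exp (-t) ≤
      ∫ t in (0 : ℝ)..ρ, t ^ (d - 1) * Real.exp (-t) := by
    rw [← intervalIntegral.integral_add_adjacent_intervals (hcont.intervalIntegrable 0 1)
      (hcont.intervalIntegrable 1 ρ)]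
    have : 0 ≤ ∫ t in (1 : ℝ)..ρ, t ^ (d - 1) * Real.exp (-t) :=
      intervalIntegral.integral_nonneg hρ fun t ht => by
        have := zero_le_one.trans ht.1
        positivity
    linarith
  rw [intervalIntegral.integral_mul_const, integral_pow, Nat.cast_sub hd, Nat.sub_add_cancel hd]
    at h1
  have h3 := h1.trans h2
  rw [Nat.cast_one, sub_add_cancel, one_pow, zero_pow (by omega), sub_zero, one_div,
    inv_mul_le_iff₀ hd'] at h3
  exact h3

/-- Exponentially small quantities are eventually below any given multiples and below the leading
term, which decays polynomially. -/
theorem exists_scale {d : ℕ} (hd : 1 ≤ d) (N : ℕ) : ∃ c : ℝ, ∀ t, c ≤ t →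
    N * Real.exp (-t / 2) ≤ 1 / 2 ∧ 2 * (N : ℝ) ^ 4 * Real.exp (-(2 * t)) ≤ 1 / 2 ∧
    4 * (N : ℝ) ^ 4 * Real.exp (-t / 2) ≤
      d * (∫ s in (0 : ℝ)..(2 * t), s ^ (d - 1) * Real.exp (-s)) / (2 * t) ^ d := by
  have hhalf : Filter.Tendsto (fun t : ℝ => t / 2) Filter.atTop Filter.atTop :=
    Filter.tendsto_id.atTop_div_const two_pos
  have hdouble : Filter.Tendsto (fun t : ℝ => 2 * t) Filter.atTop Filter.atTop :=
    Filter.tendsto_id.const_mul_atTop two_pos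
  have t1 := ((Real.tendsto_pow_mul_exp_neg_atTop_nhds_zero 0).comp hhalf).const_mul (N : ℝ)
  have t2 := ((Real.tendsto_pow_mul_exp_neg_atTop_nhds_zero 0).comp hdouble).const_mul
    (2 * (N : ℝ) ^ 4)
  have t3 := ((Real.tendsto_pow_mul_exp_neg_atTop_nhds_zero d).comp hhalf).const_mul
    (4 * (N : ℝ) ^ 4 * 4 ^ d)
  rw [mul_zero] at t1 t2 t3
  have hev := ((t1.eventually_le_const (u := 1 / 2) (by norm_num)).and
    ((t2.eventually_le_const (u := 1 / 2) (by norm_num)).and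
    ((t3.eventually_le_const (Real.exp_pos (-1))).and (Filter.eventually_ge_atTop 1))))
  obtain ⟨c, hc⟩ := Filter.eventually_atTop.1 hev
  refine ⟨c, fun t ht => ?_⟩
  obtain ⟨h1, h2, h3, h4⟩ := hc t ht
  simp only [Function.comp_apply, pow_zero, one_mul] at h1 h2 h3
  rw [← neg_div] at h1 h3
  refine ⟨h1, h2, ?_⟩
  rw [le_div_iff₀ (by positivity)]
  refine le_trans (le_of_eq ?_) (h3.trans (exp_neg_one_le_mul_integral hd (by linarith)))
  rw [show 2 * t = 4 * (t / 2) by ring, mul_pow]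
  ring

/-- The mean over the manifold of the squared similarities to the landmarks: the balls around the
landmarks are disjoint and each contributes its volume times the leading term. -/
theorem integral_sum_exp_le {d : ℕ} (hd : 1 ≤ d) {M : Type*} [MetricSpace M] [CompactSpace M]
    [MeasurableSpace M] [BorelSpace M] {ν : Measure M} [IsProbabilityMeasure ν] {c : ENNReal}
    (hν : ν = c • Measure.hausdorffMeasure (d : ℝ)) {l : ℕ} {R lam K : ℝ} (hR : 0 < R)
    (hlam : 0 < lam) (hball : ∀ x : M, IsEuclideanBall d x R) {L : Fin l → M}
    (hL : ∀ a b, a ≠ b → 2 * R ≤ dist (L a) (L b))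
    (hK : ∀ x, ∑ a with R ≤ dist x (L a), Real.exp (-dist x (L a) / lam) ≤
      K * Real.exp (-R / lam)) :
    ∫ x, ∑ a, Real.exp (-(2 * dist x (L a)) / lam) ∂ν ≤
      d * (∫ t in (0 : ℝ)..(2 * R / lam), t ^ (d - 1) * Real.exp (-t)) / (2 * R / lam) ^ d +
        K * Real.exp (-(2 * R) / lam) := by
  classical
  set G := d * (∫ t in (0 : ℝ)..(2 * R / lam), t ^ (d - 1) * Real.exp (-t)) / (2 * R / lam) ^ d
    with hG
  have hG0 : 0 ≤ G := by
    have : 0 ≤ ∫ t in (0 : ℝ)..(2 * R / lam), t ^ (d - 1) * Real.exp (-t) :=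
      intervalIntegral.integral_nonneg (by positivity) fun t ht => by
        have := ht.1
        positivity
    positivity
  set f : Fin l → M → ℝ := fun a x => Real.exp (-(2 * dist (L a) x) / lam) with hf
  have hfc : ∀ a, Continuous (f a) := fun a => by
    have : Continuous fun x => dist (L a) x := continuous_const.dist continuous_id
    simp only [hf]
    fun_prop
  have hfi : ∀ a, Integrable (f a) ν := fun a =>
    (hfc a).integrable_of_hasCompactSupport (HasCompactSupport.of_compactSpace _)
  have hfi' : ∀ a, Integrable ((Metric.ball (L a) R).indicator (f a)) ν := fun a =>
    (hfi a).indicator measurableSet_ball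
  have hpt : ∀ x, ∑ a, Real.exp (-(2 * dist x (L a)) / lam) ≤
      ∑ a, (Metric.ball (L a) R).indicator (f a) x + K * Real.exp (-(2 * R) / lam) := by
    intro x
    have hsplit := Finset.sum_filter_add_sum_filter_not Finset.univ
      (fun a => R ≤ dist x (L a)) fun a => Real.exp (-(2 * dist x (L a)) / lam)
    have hfar : ∑ a with R ≤ dist x (L a), Real.exp (-(2 * dist x (L a)) / lam) ≤
        K * Real.exp (-(2 * R) / lam) := by
      calc _ ≤ ∑ a with R ≤ dist x (L a),
            Real.exp (-R / lam) * Real.exp (-dist x (L a) / lam) := by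
            refine Finset.sum_le_sum fun a ha => ?_
            have ha : R ≤ dist x (L a) := (Finset.mem_filter.1 ha).2
            rw [← Real.exp_add, ← add_div]
            gcongr
            linarith
        _ ≤ Real.exp (-R / lam) * (K * Real.exp (-R / lam)) := by
            rw [← Finset.mul_sum]
            gcongr
            exact hK x
        _ = K * (Real.exp (-R / lam) * Real.exp (-R / lam)) := by ring
        _ = K * Real.exp (-(2 * R) / lam) := by
            rw [← Real.exp_add]
            congr 2
            ring
    have hnear : ∑ a with ¬ R ≤ dist x (L a), Real.exp (-(2 * dist x (L a)) / lam) =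
        ∑ a, (Metric.ball (L a) R).indicator (f a) x := by
      rw [Finset.sum_filter]
      refine Finset.sum_congr rfl fun a _ => ?_
      simp only [Set.indicator_apply, Metric.mem_ball, not_le, hf, dist_comm]
    linarith
  calc _ ≤ ∫ x, (∑ a, (Metric.ball (L a) R).indicator (f a) x +
          K * Real.exp (-(2 * R) / lam)) ∂ν := by
        refine integral_mono ?_
          ((integrable_finsetSum _ fun a _ => hfi' a).add (integrable_const _)) hpt
        have := integrable_finsetSum Finset.univ fun a _ => hfi a
        simpa only [hf, dist_comm] using this
    _ = (∑ a, ν.real (Metric.ball (L a) R)) * G + K * Real.exp (-(2 * R) / lam) := by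
        rw [integral_add (integrable_finsetSum _ fun a _ => hfi' a) (integrable_const _),
          integral_finsetSum _ fun a _ => hfi' a, Finset.sum_mul]
        congr 1
        · refine Finset.sum_congr rfl fun a _ => ?_
          rw [integral_indicator measurableSet_ball]
          exact setIntegral_exp_dist hd hν hR hlam (hball (L a))
        · simp
    _ ≤ 1 * G + K * Real.exp (-(2 * R) / lam) := by
        gcongr
        rw [← measureReal_biUnion_finset]
        · exact measureReal_le_one
        · intro a _ b _ hab
          exact Metric.ball_disjoint_ball (by linarith [hL a b hab])
        · exact fun _ _ => measurableSet_ball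
    _ = _ := by rw [one_mul]

/-! ### The Nyström kernel -/

/-- For landmarks that are far apart on the scale of the kernel, the matrix between the landmarks is
invertible and the Nyström kernel is at most the product kernel up to an exponentially small
error. -/
theorem nystrom_le {M : Type*} [MetricSpace M] {l : ℕ} {R lam K : ℝ} {L : Fin l → M}
    (hL : ∀ a b, a ≠ b → 2 * R ≤ dist (L a) (L b)) (hlam : 0 < lam)
    (hK : ∀ x, ∀ s, 0 ≤ s → s ≤ 2 * R → ∑ a with s ≤ dist x (L a),
      Real.exp (-dist x (L a) / lam) ≤ K * Real.exp (-s / lam))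
    (hR : 0 < R) (hK0 : 0 ≤ K) (hsmall : K * Real.exp (-(2 * R) / lam) ≤ 1 / 2) :
    IsUnit (kernelMatrix lam L L).det ∧ ∀ {ι κ : Type*} (x : ι → M) (y : κ → M) (i : ι) (j : κ),
      nystrom lam L x y i j ≤
        ∑ a, Real.exp (-dist (x i) (L a) / lam) * Real.exp (-dist (y j) (L a) / lam) +
          2 * K ^ 2 * Real.exp (-(2 * R) / lam) := by
  obtain ⟨h1, h2⟩ := dotProduct_inv_mulVec_le (A := kernelMatrix lam L L) hsmall
    (by simp [kernelMatrix])
    (by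
      intro a
      refine le_trans ?_ (hK (L a) (2 * R) (by linarith) le_rfl)
      simp only [kernelMatrix, Matrix.of_apply, Real.abs_exp]
      refine Finset.sum_le_sum_of_subset_of_nonneg (fun b hb => ?_) fun _ _ _ =>
        (Real.exp_pos _).le
      simpa using hL a b (Finset.ne_of_mem_erase hb).symm)
  refine ⟨h1, fun {ι κ} x y i j => ?_⟩
  rw [nystrom_apply]
  refine (h2 _ _ (fun a => (Real.exp_pos _).le) fun a => ?_).trans ?_
  · rw [Real.abs_exp, Real.exp_le_one_iff]
    exact div_nonpos_of_nonpos_of_nonneg (neg_nonpos.2 dist_nonneg) hlam.le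
  · have hsum : ∑ a, Real.exp (-dist (x i) (L a) / lam) ≤ K := by
      simpa using hK (x i) 0 le_rfl (by linarith)
    have := mul_le_mul_of_nonneg_left hsum
      (show 0 ≤ 2 * (K * Real.exp (-(2 * R) / lam)) by positivity)
    rw [dotProduct]
    linarith

theorem sum_mul_exp_le_half {M : Type*} [MetricSpace M] {l : ℕ} (lam : ℝ) (L : Fin l → M)
    (x y : M) : ∑ a, Real.exp (-dist x (L a) / lam) * Real.exp (-dist y (L a) / lam) ≤
      (∑ a, Real.exp (-(2 * dist x (L a)) / lam) +
        ∑ a, Real.exp (-(2 * dist y (L a)) / lam)) / 2 := by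
  rw [← Finset.sum_add_distrib, Finset.sum_div]
  refine Finset.sum_le_sum fun a _ => ?_
  have e : ∀ z : M, Real.exp (-(2 * dist z (L a)) / lam) = Real.exp (-dist z (L a) / lam) ^ 2 := by
    intro z
    rw [← Real.exp_nat_mul]
    congr 1
    push_cast
    ring
  rw [e, e]
  nlinarith [sq_nonneg (Real.exp (-dist x (L a) / lam) - Real.exp (-dist y (L a) / lam))]

/-- Two points at a distance of at least `R` have no common landmark within `R / 2`. -/
theorem sum_mul_exp_le_of_le_dist {M : Type*} [MetricSpace M] {l : ℕ} {R lam K : ℝ} {L : Fin l → M}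
    (hlam : 0 < lam) (hK : ∀ x, ∑ a with R / 2 ≤ dist x (L a), Real.exp (-dist x (L a) / lam) ≤
      K * Real.exp (-(R / 2) / lam)) {x y : M} (hxy : R ≤ dist x y) :
    ∑ a, Real.exp (-dist x (L a) / lam) * Real.exp (-dist y (L a) / lam) ≤
      2 * (K * Real.exp (-(R / 2) / lam)) := by
  have hle : ∀ z w, Real.exp (-dist z w / lam) ≤ 1 := fun z w : M =>
    Real.exp_le_one_iff.2 (div_nonpos_of_nonpos_of_nonneg (neg_nonpos.2 dist_nonneg) hlam.le)
  refine le_trans ?_ ((add_le_add (hK x) (hK y)).trans_eq (two_mul _).symm)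
  rw [Finset.sum_filter, Finset.sum_filter, ← Finset.sum_add_distrib]
  refine Finset.sum_le_sum fun a _ => ?_
  have px := Real.exp_pos (-dist x (L a) / lam)
  have py := Real.exp_pos (-dist y (L a) / lam)
  have hx := hle x (L a)
  have hy := hle y (L a)
  have tri := dist_triangle_right x y (L a)
  split_ifs <;> nlinarith

/-! ### The sample -/

theorem map_prod_eq_of_iIndepFun {M Ω : Type*} [MeasurableSpace M] [MeasurableSpace Ω]
    {P : Measure Ω} [IsProbabilityMeasure P] {n : ℕ} {xp xq : Fin n → Ω → M}
    (hxp : ∀ j, Measurable (xp j)) (hxq : ∀ j, Measurable (xq j))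
    (hind : iIndepFun (Sum.elim xp xq) P) {ν : Measure M} [IsProbabilityMeasure ν]
    (hp : ∀ j, P.map (xp j) = ν) (hq : ∀ j, P.map (xq j) = ν) (i : Fin n) :
    P.map (fun ω => (xp i ω, fun j => xq j ω)) = ν.prod (Measure.pi fun _ : Fin n => ν) := by
  set g : Fin (n + 1) → Fin n ⊕ Fin n := Fin.cons (Sum.inl i) Sum.inr with hg
  have hginj : Function.Injective g :=
    Fin.cons_injective_iff.2 ⟨by simp, Sum.inr_injective⟩
  have hgm : ∀ a, Measurable (Sum.elim xp xq (g a)) := by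
    intro a
    cases g a with
    | inl j => exact hxp j
    | inr j => exact hxq j
  have hgmap : ∀ a, P.map (Sum.elim xp xq (g a)) = ν := by
    intro a
    cases g a with
    | inl j => exact hp j
    | inr j => exact hq j
  have h := (iIndepFun_iff_map_fun_eq_pi_map fun a => (hgm a).aemeasurable).1
    (hind.precomp hginj)
  simp only [hgmap] at h
  rw [← (measurePreserving_piFinSuccAbove (fun _ : Fin (n + 1) => ν) 0).map_eq, ← h,
    Measure.map_map (MeasurableEquiv.measurable _) (measurable_pi_lambda _ hgm)]
  rfl

theorem eq_smul_of_isUniform_univ {M Ω : Type*} [MeasurableSpace M] [MeasurableSpace Ω]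
    {P : Measure Ω} {X : Ω → M} {μ : Measure M} (h : pdf.IsUniform X Set.univ P μ) :
    P.map X = (μ Set.univ)⁻¹ • μ := by
  rw [show P.map X = μ[|Set.univ] from h, ProbabilityTheory.cond, Measure.restrict_univ]

theorem measurable_nystrom {M Ω : Type*} [MetricSpace M] [CompactSpace M] [MeasurableSpace M]
    [BorelSpace M] [MeasurableSpace Ω] {n l : ℕ} (lam : ℝ) (L : Fin l → M)
    {xp xq : Fin n → Ω → M} {ik : Ω → Fin n} {i : Fin n} (hxp : Measurable (xp i))
    (hxq : Measurable fun ω => xq (ik ω) ω) :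
    Measurable fun ω => nystrom lam L (fun j => xp j ω) (fun j => xq j ω) i (ik ω) := by
  simp only [nystrom_apply, dotProduct, Matrix.mulVec]
  have hdist : ∀ {Z : Ω → M}, Measurable Z → ∀ a,
      Measurable fun ω => Real.exp (-dist (Z ω) (L a) / lam) := fun hZ a =>
    ((hZ.dist measurable_const).neg.div_const lam).exp
  exact Finset.measurable_sum _ fun a _ => (hdist hxp a).mul
    (Finset.measurable_sum _ fun b _ => (hdist hxq b).const_mul _)

theorem abs_nystrom_le {M : Type*} [MetricSpace M] {l : ℕ} {lam : ℝ} (hlam : 0 < lam)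
    (L : Fin l → M) : ∃ C : ℝ, ∀ {ι κ : Type*} (x : ι → M) (y : κ → M) (i : ι) (j : κ),
      |nystrom lam L x y i j| ≤ C := by
  refine ⟨∑ a, ∑ b, |(kernelMatrix lam L L)⁻¹ a b|, fun {ι κ} x y i j => ?_⟩
  have hle : ∀ z w, Real.exp (-dist z w / lam) ≤ 1 := fun z w : M =>
    Real.exp_le_one_iff.2 (div_nonpos_of_nonpos_of_nonneg (neg_nonpos.2 dist_nonneg) hlam.le)
  rw [nystrom_apply, dotProduct]
  refine (Finset.abs_sum_le_sum_abs _ _).trans (Finset.sum_le_sum fun a _ => ?_)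
  rw [abs_mul, Real.abs_exp, Matrix.mulVec, dotProduct]
  refine (mul_le_of_le_one_left (abs_nonneg _) (hle _ _)).trans
    ((Finset.abs_sum_le_sum_abs _ _).trans (Finset.sum_le_sum fun b _ => ?_))
  rw [abs_mul, Real.abs_exp]
  exact mul_le_of_le_one_right (abs_nonneg _) (hle _ _)

end NystromError

theorem theorem1 (d : ℕ) (hd : 1 ≤ d) :
    -- the implied constants of the `O`-term (for `R / lam → ∞`) depend on the dimension only
    ∃ C c : ℝ,
      ∀ (M : Type*) [MetricSpace M] [MeasurableSpace M] [BorelSpace M]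
        (Ω : Type*) [MeasurableSpace Ω] (P : Measure Ω) [IsProbabilityMeasure P]
        (n k l : ℕ) (R lam : ℝ) (L : Fin l → M)
        (xp xq : Fin n → Ω → M) (i : Fin n) (ik : Ω → Fin n),
        NystromError.IsClosedLocallyEuclidean d M →
        0 < R → 0 < lam → 1 ≤ k → k ≤ n →
        -- the (deterministic) landmarks
        (∀ a b, a ≠ b → 2 * R ≤ dist (L a) (L b)) →
        -- independent samples, uniform with respect to the volume
        (∀ j, Measurable (xp j)) → (∀ j, Measurable (xq j)) →
        iIndepFun (Sum.elim xp xq) P →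
        (∀ j, pdf.IsUniform (xp j) Set.univ P (Measure.hausdorffMeasure (d : ℝ))) →
        (∀ j, pdf.IsUniform (xq j) Set.univ P (Measure.hausdorffMeasure (d : ℝ))) →
        -- `xq (ik ω) ω` is the `k`-th nearest neighbor of `xp i ω`
        Measurable ik →
        (∀ᵐ ω ∂P, NystromError.IsKthNearest k (xp i ω) (fun j => xq j ω) (ik ω)) →
        (Integrable (fun ω => NystromError.kernelMatrix lam (fun j => xp j ω)
            (fun j => xq j ω) i (ik ω)) P ∧
          Integrable (fun ω => NystromError.nystrom lam L (fun j => xp j ω)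
            (fun j => xq j ω) i (ik ω)) P ∧
          Integrable (fun ω => Real.exp
            (-NystromError.kthNearestDist k (xp i ω) (fun j => xq j ω) / lam)) P ∧
          ∫ ω, (NystromError.kernelMatrix lam (fun j => xp j ω) (fun j => xq j ω) i (ik ω) -
              NystromError.nystrom lam L (fun j => xp j ω) (fun j => xq j ω) i (ik ω)) ∂P =
            (∫ ω, Real.exp
              (-NystromError.kthNearestDist k (xp i ω) (fun j => xq j ω) / lam) ∂P) -
            ∫ ω, NystromError.nystrom lam L (fun j => xp j ω) (fun j => xq j ω) i (ik ω) ∂P) ∧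
        -- the bound, if the manifold is Euclidean at the scale `R`
        ((∀ x : M, NystromError.IsEuclideanBall d x R) → c ≤ R / lam →
          IsUnit (NystromError.kernelMatrix lam L L).det ∧
          ∫ ω, NystromError.nystrom lam L (fun j => xp j ω) (fun j => xq j ω) i (ik ω) ∂P ≤
            d * (Real.Gamma d - NystromError.upperGamma d (2 * R / lam)) / (2 * R / lam) ^ d +
              C * Real.exp (-(2 * R) / lam)) := by
  classical
  obtain ⟨N, hN⟩ := NystromError.exists_cover_isEuclideanBall d
  obtain ⟨c, hc⟩ := NystromError.exists_scale hd N
  set K : ℝ := 2 * N ^ 4 with hKdef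
  have hK0 : 0 ≤ K := by positivity
  refine ⟨2 * K ^ 2 + K, c, ?_⟩
  intro M _ _ _ Ω _ P _ n k l R lam L xp xq i ik hM hR hlam _ _ hL hxp hxq hind hup huq hikm hik
  have := hM.compact
  have hym : Measurable fun ω => xq (ik ω) ω :=
    measurable_from_prod_countable_right (f := fun p : Fin n × Ω => xq p.1 p.2) hxq |>.comp
      (hikm.prodMk measurable_id)
  have hker : Integrable (fun ω => NystromError.kernelMatrix lam (fun j => xp j ω)
      (fun j => xq j ω) i (ik ω)) P := by
    refine Integrable.of_bound (C := 1)
      (((hxp i).dist hym).neg.div_const lam).exp.aestronglyMeasurable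
      (Filter.Eventually.of_forall fun ω => ?_)
    rw [Real.norm_eq_abs, NystromError.kernelMatrix, Matrix.of_apply, Real.abs_exp,
      Real.exp_le_one_iff]
    exact div_nonpos_of_nonpos_of_nonneg (neg_nonpos.2 dist_nonneg) hlam.le
  have hnys : Integrable (fun ω => NystromError.nystrom lam L (fun j => xp j ω)
      (fun j => xq j ω) i (ik ω)) P := by
    obtain ⟨C, hC⟩ := NystromError.abs_nystrom_le hlam L
    exact Integrable.of_bound
      (NystromError.measurable_nystrom lam L (hxp i) hym).aestronglyMeasurable C
      (Filter.Eventually.of_forall fun ω => hC _ _ _ _)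
  have hkth : (fun ω => NystromError.kernelMatrix lam (fun j => xp j ω)
      (fun j => xq j ω) i (ik ω)) =ᵐ[P] fun ω => Real.exp
        (-NystromError.kthNearestDist k (xp i ω) (fun j => xq j ω) / lam) := by
    filter_upwards [hik] with ω hω
    rw [NystromError.kthNearestDist_eq hω, NystromError.kernelMatrix, Matrix.of_apply]
  refine ⟨⟨hker, hnys, hker.congr hkth, ?_⟩, fun hball hcR => ?_⟩
  · rw [integral_sub hker hnys, integral_congr_ae hkth]
  obtain ⟨hsc1, hsc2, hsc3⟩ := hc (R / lam) hcR
  have e1 : -(R / lam) / 2 = -(R / 2) / lam := by ring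
  have e2 : -(2 * (R / lam)) = -(2 * R) / lam := by ring
  have e3 : 2 * (R / lam) = 2 * R / lam := by ring
  rw [e1] at hsc1
  rw [e2] at hsc2
  rw [e1, e3] at hsc3
  have hK : ∀ x, ∀ s, 0 ≤ s → s ≤ 2 * R → ∑ a with s ≤ dist x (L a),
      Real.exp (-dist x (L a) / lam) ≤ K * Real.exp (-s / lam) := fun x s _ hs =>
    NystromError.sum_exp_le hR hlam hL
      (NystromError.exists_cover_ball hM.geodesic (fun x => hN M x R hR (hball x)) x) hsc1 hs
  obtain ⟨hdet, hle⟩ := NystromError.nystrom_le hL hlam hK hR hK0 hsc2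
  refine ⟨hdet, ?_⟩
  -- the common law of all sample points
  set ν : Measure M := P.map (xp i) with hνdef
  have hνc : ν = (Measure.hausdorffMeasure (d : ℝ) (Set.univ : Set M))⁻¹ •
      Measure.hausdorffMeasure (d : ℝ) := NystromError.eq_smul_of_isUniform_univ (hup i)
  have hνp : IsProbabilityMeasure ν := Measure.isProbabilityMeasure_map (hxp i).aemeasurable
  have hlaw := NystromError.map_prod_eq_of_iIndepFun hxp hxq hind (ν := ν)
    (fun j => (NystromError.eq_smul_of_isUniform_univ (hup j)).trans hνc.symm)
    (fun j => (NystromError.eq_smul_of_isUniform_univ (huq j)).trans hνc.symm) i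
  obtain ⟨x₀⟩ := hM.nonempty
  have hθp : IsProbabilityMeasure (ν.map fun y => min (dist x₀ y) R) :=
    Measure.isProbabilityMeasure_map
      ((continuous_const.dist continuous_id).min continuous_const).measurable.aemeasurable
  set G : ℝ := d * (∫ t in (0 : ℝ)..(2 * R / lam), t ^ (d - 1) * Real.exp (-t)) /
    (2 * R / lam) ^ d with hG
  set E : ℝ := Real.exp (-(2 * R) / lam) with hE
  have hE0 : 0 ≤ E := (Real.exp_pos _).le
  have hh : Continuous fun x : M => ∑ a, Real.exp (-(2 * dist x (L a)) / lam) := by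
    have : ∀ a, Continuous fun x : M => dist x (L a) := fun a => continuous_id.dist continuous_const
    exact continuous_finsetSum _ fun a _ =>
      Real.continuous_exp.comp (((this a).const_mul 2).neg.div_const lam)
  have key := NystromError.integral_le_of_kthNearest (k := k) (R := R)
    (fun x => NystromError.map_min_dist_eq hνc hball x x₀)
    (fun r hr => NystromError.map_min_dist_singleton hd hνc (hball x₀) hr)
    (hxp i) hxq hlaw hik hh.measurable (C := l)
    (fun x => by
      rw [abs_of_nonneg (Finset.sum_nonneg fun a _ => (Real.exp_pos _).le)]
      refine (Finset.sum_le_card_nsmul _ _ 1 fun a _ => ?_).trans (by simp)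
      exact Real.exp_le_one_iff.2 (div_nonpos_of_nonpos_of_nonneg
        (neg_nonpos.2 (mul_nonneg two_pos.le dist_nonneg)) hlam.le))
    (F := fun ω => NystromError.nystrom lam L (fun j => xp j ω) (fun j => xq j ω) i (ik ω) -
      2 * K ^ 2 * E) (hnys.sub (integrable_const _)) (G := G) (ε := K * E) (by positivity)
    (NystromError.integral_sum_exp_le hd hνc hR hlam hball hL fun x => hK x R hR.le (by linarith))
    (fun ω _ => by
      have h1 := hle (fun j => xp j ω) (fun j => xq j ω) i (ik ω)
      have h2 := NystromError.sum_mul_exp_le_half lam L (xp i ω) (xq (ik ω) ω)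
      linarith)
    (fun ω hω => by
      have h1 := hle (fun j => xp j ω) (fun j => xq j ω) i (ik ω)
      have h2 := NystromError.sum_mul_exp_le_of_le_dist hlam
        (fun x => hK x (R / 2) (by linarith) (by linarith)) hω
      linarith)
  rw [integral_sub hnys (integrable_const _), integral_const, probReal_univ, one_smul] at key
  rw [NystromError.gamma_sub_upperGamma hd (by positivity)]
  linarith
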